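/- Let $(M^n,g)$ be a smooth Riemannian manifold (without boundary) and let $TM^n$ carry the Sasaki metric $\langle\langle X,Y\rangle\rangle=\langle\pi_*X,\pi_*Y\rangle+\langle KX,KY\rangle$, where $\pi:TM^n\to M^n$ is the projection and $K$ is the connection map of the Levi-Civita connection of $g$. Let $J\subseteq\mathbb R$ be open (for example an open interval), let $\gamma:J\to M^n$ be a geodesic ($\nabla_{\gamma'}\gamma'=0$), let $e$ be a smooth unit vector field along $\gamma$ which is parallel along $\gamma$, and let $\rho:J\to\mathbb R$ be an arbitrary smooth function. Then the cylinder-type surface $$r:J\times\mathbb R\to TM^n,\qquad r(s,t)=\big(\gamma(s),\,t\,\rho(s)\,e(s)\big),$$ is smooth; it is regular (has injective differential) at $(s,t)$ if and only if $\gamma'(s)\neq0$ and $\rho(s)\ne 0$; and at each of its regular points it is totally geodesic in $TM^n$ with the Sasaki metric (its second fundamental form vanishes) and intrinsically flat (the curvature tensor of the metric induced on the surface vanishes). -/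

import Mathlib

open Set
open scoped Manifold ContDiff Bundle

noncomputable section

namespace SasakiCylinder

/-! ## Riemannian metrics in coordinates

A metric on (an open subset of) a normed space `P` is a field `h : P → P →L[ℝ] P →L[ℝ] ℝ` of
bilinear forms; all indices are contracted with vectors of `P`. -/

section Coordinates

variable {P : Type*} [NormedAddCommGroup P] [NormedSpace ℝ P]

/-- The Christoffel symbols of the first kind of `h` at `y`, as a form trilinear in `v`, `w`, `z`:
`½ (∂ᵥ h(w,z) + ∂_w h(v,z) - ∂_z h(v,w))`, see `koszulForm_apply`. -/
def koszulForm (h : P → P →L[ℝ] P →L[ℝ] ℝ) (y v : P) : P →L[ℝ] P →L[ℝ] ℝ :=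
  (2⁻¹ : ℝ) •
    (fderiv ℝ h y v + (fderiv ℝ h y).flip v - ((fderiv ℝ h y).flip v).flip)

theorem koszulForm_apply (h : P → P →L[ℝ] P →L[ℝ] ℝ) (y v w z : P) :
    koszulForm h y v w z =
      2⁻¹ * (fderiv ℝ h y v w z + fderiv ℝ h y w v z - fderiv ℝ h y z v w) := by
  rfl

/-- The Christoffel symbols (of the second kind) `Γ(v,w) = Γⁱⱼₖ vʲ wᵏ ∂ᵢ` of `h` at `y`: the last
index of `koszulForm` is raised by `h y`, i.e. `h_y(Γ(v,w), z) = koszulForm h y v w z`. -/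
def christoffel (h : P → P →L[ℝ] P →L[ℝ] ℝ) (y v : P) : P →L[ℝ] P :=
  (h y).inverse.comp (koszulForm h y v)

theorem apply_christoffel (h : P → P →L[ℝ] P →L[ℝ] ℝ) (y : P) (hy : (h y).IsInvertible)
    (v w z : P) : h y (christoffel h y v w) z = koszulForm h y v w z := by
  simp [christoffel, hy]

/-- The bilinear form `(u, v) ↦ B(A u, A v)`. -/
def restrictForm {P' : Type*} [NormedAddCommGroup P'] [NormedSpace ℝ P']
    (B : P →L[ℝ] P →L[ℝ] ℝ) (A : P' →L[ℝ] P) : P' →L[ℝ] P' →L[ℝ] ℝ :=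
  B.bilinearComp A A

/-- The Riemann curvature `R(u,v)w` of `h` at `y`, with
`R(u,v)w = (∂ᵤΓ)(v,w) - (∂ᵥΓ)(u,w) + Γ(u,Γ(v,w)) - Γ(v,Γ(u,w))`. -/
def curvature (h : P → P →L[ℝ] P →L[ℝ] ℝ) (y u v w : P) : P :=
  fderiv ℝ (fun q => christoffel h q v w) y u - fderiv ℝ (fun q => christoffel h q u w) y v
    + christoffel h y u (christoffel h y v w) - christoffel h y v (christoffel h y u w)

end Coordinates

/-! ## Metrics and Levi-Civita connection on a manifold without boundary -/

section Manifold

variable {E : Type*} [NormedAddCommGroup E] [NormedSpace ℝ E]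
  {H : Type*} [TopologicalSpace H] {I : ModelWithCorners ℝ E H}
  {N : Type*} [TopologicalSpace N] [ChartedSpace H N]
  {P : Type*} [NormedAddCommGroup P] [NormedSpace ℝ P]

variable (I N) in
/-- A field of bilinear forms on the tangent spaces of `N`. -/
abbrev BilinField : Type _ :=
  ∀ x : N, TangentSpace I x →L[ℝ] TangentSpace I x →L[ℝ] ℝ

/-- The pull-back (first fundamental form) `(u, v) ↦ G(df u, df v)` of `G` under `f : P → N`. -/
def pullbackMetric (G : BilinField I N) (f : P → N) (p : P) : P →L[ℝ] P →L[ℝ] ℝ :=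
  restrictForm (P := E) (P' := P) (G (f p)) (mfderiv 𝓘(ℝ, P) I f p)

/-- The Christoffel symbols of `G` at `x`, computed in the preferred chart at `x`. The vector space
`TangentSpace I x` is `E`, a tangent vector being represented by its components in that chart.
(The manifold has no boundary, so that the chart has an open image.) -/
def christoffelAt (G : BilinField I N) (x : N) (v : E) : E →L[ℝ] E :=
  christoffel (pullbackMetric G (extChartAt I x).symm) (extChartAt I x x) v

variable [IsManifold I 1 N]

/-- The connection map `K : T_Q TN → T_q N` of the Levi-Civita connection of `G`, `Q = (q, ξ)`:
`(K X)ⁱ = Xⁿ⁺ⁱ + Γⁱⱼₖ(q) ξʲ Xᵏ`. Here `TangentSpace I.tangent Q` is `E × E`, a tangent vector being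
represented by its components `(Xⁱ, Xⁿ⁺ⁱ)` in the preferred chart of `TN` at `Q`, and this is the
natural chart induced on `TN` by the preferred chart of `N` at `q`. -/
def connectionMap (G : BilinField I N) (Q : TangentBundle I N) :
    TangentSpace I.tangent Q →L[ℝ] TangentSpace I Q.proj :=
  (ContinuousLinearMap.snd ℝ E E +
    (christoffelAt G Q.proj Q.snd).comp (ContinuousLinearMap.fst ℝ E E) : E × E →L[ℝ] E)

/-- The Sasaki metric `⟨⟨X, Y⟩⟩ = ⟨π_* X, π_* Y⟩ + ⟨K X, K Y⟩` on the tangent bundle. -/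
def sasakiMetric (G : BilinField I N) : BilinField I.tangent (TangentBundle I N) := fun Q =>
  (restrictForm (P := E) (P' := E × E) (G Q.proj)
      (mfderiv I.tangent I (Bundle.TotalSpace.proj : TangentBundle I N → N) Q) +
    restrictForm (P := E) (P' := E × E) (G Q.proj) (connectionMap G Q) :
      E × E →L[ℝ] E × E →L[ℝ] ℝ)

/-- The Levi-Civita covariant derivative at `p`, in the direction `u`, of a vector field `V` along
a map `f : P → N`: the connection map applied to the derivative of `p ↦ (f p, V p) ∈ TN`. -/
def covDerivAlong (G : BilinField I N) (f : P → N) (V : ∀ p : P, TangentSpace I (f p)) (p u : P) :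
    TangentSpace I (f p) :=
  connectionMap G (⟨f p, V p⟩ : TangentBundle I N)
    (mfderiv 𝓘(ℝ, P) I.tangent (fun q => (⟨f q, V q⟩ : TangentBundle I N)) p u)

variable (I) in
/-- The velocity vector `γ'(s)`. -/
def velocity (γ : ℝ → N) (s : ℝ) : TangentSpace I (γ s) :=
  mfderiv 𝓘(ℝ, ℝ) I γ s (1 : ℝ)

/-- `γ` restricted to the open set `J` is a smooth solution of `∇_{γ'} γ' = 0`. -/
def IsGeodesicOn (G : BilinField I N) (γ : ℝ → N) (J : Set ℝ) : Prop :=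
  ContMDiffOn 𝓘(ℝ, ℝ) I ∞ γ J ∧ ∀ s ∈ J, covDerivAlong G γ (velocity I γ) s 1 = 0

/-- `V` is a smooth vector field along `γ` over the open set `J` with `∇_{γ'} V = 0`. -/
def IsParallelAlongOn (G : BilinField I N) (γ : ℝ → N) (V : ∀ s : ℝ, TangentSpace I (γ s))
    (J : Set ℝ) : Prop :=
  ContMDiffOn 𝓘(ℝ, ℝ) I.tangent ∞ (fun s => (⟨γ s, V s⟩ : TangentBundle I N)) J ∧
    ∀ s ∈ J, covDerivAlong G γ V s 1 = 0

/-- The differential of `f` at `p` is injective. -/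
def IsRegularAt (I : ModelWithCorners ℝ E H) (f : P → N) (p : P) : Prop :=
  Function.Injective (mfderiv 𝓘(ℝ, P) I f p)

/-- The second fundamental form of the immersion `f` vanishes at `p`: for all `u`, `v`, the
derivative `∇_{∂ᵤ} ∂ᵥ f` of the coordinate field `∂ᵥ f` is tangent to the image of `f`. -/
def IsTotallyGeodesicAt (G : BilinField I N) (f : P → N) (p : P) : Prop :=
  ∀ u v : P, ∃ w : P,
    covDerivAlong G f (fun q => mfderiv 𝓘(ℝ, P) I f q v) p u = mfderiv 𝓘(ℝ, P) I f p w

/-- The curvature tensor of the metric induced by the immersion `f` vanishes at `p`. -/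
def IsIntrinsicallyFlatAt (G : BilinField I N) (f : P → N) (p : P) : Prop :=
  ∀ u v w : P, curvature (pullbackMetric G f) p u v w = 0

variable (I) in
/-- The cylinder-type surface `(s, t) ↦ (γ(s), t ρ(s) e(s))` in the tangent bundle. -/
def cylinder (γ : ℝ → N) (e : ∀ s : ℝ, TangentSpace I (γ s)) (ρ : ℝ → ℝ) (p : ℝ × ℝ) :
    TangentBundle I N :=
  ⟨γ p.1, (p.2 * ρ p.1) • e p.1⟩

end Manifold

end SasakiCylinder

end

/-! Since `e` is parallel, differentiating `r = (γ, tρe)` in the direction `u` gives `π_* r_u =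
u₁γ'` and `K r_u = d(tρ)(u) e`. The pair `(π_*, K)` is injective on each tangent space of `TM`, so
`r` is regular exactly where `γ' ≠ 0` and `ρ ≠ 0` (`isRegularAt_cylinder_iff`). The induced metric
is `|γ'|² ds² + d(tρ)²`, and `|γ'|` is locally constant because `γ` is a geodesic; in the
coordinates `(s, tρ)` this metric has constant coefficients, hence is flat
(`curvature_eq_zero_of_eventuallyEq_cylinderForm`).

For total geodesy the Koszul formula shows that `∇_u r_v` is the vertical lift of `k e`, where `k`
is the Hessian of `tρ` at `(u, v)`; this is `(k/ρ) r_t`, which is tangent. The only curvature that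
could enter is `g(R(Z, γ')e, e)`, which is zero by antisymmetry. The calculation is
`exists_covDeriv_coordCylinder_eq`, in the natural coordinates of the tangent bundle.

It remains to pass between manifold and coordinates. `connectionMap` is defined at each point by the
preferred chart of that point, whereas derivatives of the Sasaki metric need one chart on a
neighbourhood. The transformation law of the Christoffel symbols makes the covariant derivative
chart-independent (`tangentCoordChange_covDerivAlong`), which identifies the Sasaki metric with
`sasakiForm` on a whole natural chart (`pullbackMetric_sasakiMetric`). -/

noncomputable section

set_option maxSynthPendingDepth 3
set_option synthInstance.maxHeartbeats 200000

namespace SasakiCylinder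

/-! ### Calculus of bilinear forms and Christoffel symbols. -/

section BilinearForms

open Filter Topology

variable {P : Type*} [NormedAddCommGroup P] [NormedSpace ℝ P]
  {P' : Type*} [NormedAddCommGroup P'] [NormedSpace ℝ P']

/-- A definite form is injective into a dual of the same dimension. Invertibility is needed
throughout because `christoffel` uses `inverse`, which is zero on non-invertible forms. -/
theorem isInvertible_of_posDef [FiniteDimensional ℝ P] {B : P →L[ℝ] P →L[ℝ] ℝ}
    (hB : ∀ v, v ≠ 0 → 0 < B v v) : B.IsInvertible := by
  have hinj : Function.Injective (B : P →ₗ[ℝ] P →L[ℝ] ℝ) := by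
    refine (injective_iff_map_eq_zero _).2 fun v hv => ?_
    by_contra hne
    have := hB v hne
    have h0 : B v = 0 := hv
    simp [h0] at this
  have hfin : Module.finrank ℝ P = Module.finrank ℝ (P →L[ℝ] ℝ) := by
    rw [← (LinearMap.toContinuousLinearMap (𝕜 := ℝ) (E := P) (F' := ℝ)).finrank_eq]
    exact (Subspace.dual_finrank_eq (K := ℝ) (V := P)).symm
  refine ⟨(LinearEquiv.ofInjectiveOfFinrankEq
    (B : P →ₗ[ℝ] P →L[ℝ] ℝ) hinj hfin).toContinuousLinearEquiv, ?_⟩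
  ext v w
  rfl

theorem restrictForm_apply (B : P →L[ℝ] P →L[ℝ] ℝ) (A : P' →L[ℝ] P) (v w : P') :
    restrictForm B A v w = B (A v) (A w) := rfl

theorem IsInvertible.apply_ext {B : P →L[ℝ] P →L[ℝ] ℝ} (hB : B.IsInvertible) {v w : P}
    (h : ∀ z, B v z = B w z) : v = w := by
  obtain ⟨e, rfl⟩ := hB
  exact e.injective (ContinuousLinearMap.ext h)

/-- The product rule for `x ↦ B x (a x) (b x)`. -/
theorem fderiv_bilin_apply {B : P' → P →L[ℝ] P →L[ℝ] ℝ} {a b : P' → P} {x : P'}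
    (hB : DifferentiableAt ℝ B x) (ha : DifferentiableAt ℝ a x) (hb : DifferentiableAt ℝ b x)
    (u : P') :
    fderiv ℝ (fun x' => B x' (a x') (b x')) x u =
      fderiv ℝ B x u (a x) (b x) + B x (fderiv ℝ a x u) (b x) + B x (a x) (fderiv ℝ b x u) := by
  have h := (hB.hasFDerivAt.clm_apply ha.hasFDerivAt).clm_apply hb.hasFDerivAt
  rw [h.fderiv]
  simp
  ring

theorem fderiv_bilin_apply_const {B : P' → P →L[ℝ] P →L[ℝ] ℝ} {x : P'}
    (hB : DifferentiableAt ℝ B x) (v w : P) (u : P') :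
    fderiv ℝ (fun x' => B x' v w) x u = fderiv ℝ B x u v w := by
  have := fderiv_bilin_apply (a := fun _ => v) (b := fun _ => w) hB (by fun_prop) (by fun_prop) u
  simpa using this

theorem fderiv_symm_of_eventually {B : P' → P →L[ℝ] P →L[ℝ] ℝ} {x : P'}
    (hB : DifferentiableAt ℝ B x) (hs : ∀ᶠ x' in 𝓝 x, ∀ v w, B x' v w = B x' w v)
    (u : P') (v w : P) : fderiv ℝ B x u v w = fderiv ℝ B x u w v := by
  rw [← fderiv_bilin_apply_const hB, ← fderiv_bilin_apply_const hB]
  congr 1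
  exact Filter.EventuallyEq.fderiv_eq (hs.mono fun x' h => h v w)

theorem ContDiffAt.restrictForm {n : WithTop ℕ∞} {Q : Type*} [NormedAddCommGroup Q]
    [NormedSpace ℝ Q] {B : Q → P →L[ℝ] P →L[ℝ] ℝ} {A : Q → P' →L[ℝ] P} {x : Q}
    (hB : ContDiffAt ℝ n B x) (hA : ContDiffAt ℝ n A x) :
    ContDiffAt ℝ n (fun x => restrictForm (B x) (A x)) x := by
  have h1 : ContDiffAt ℝ n (fun x => ((B x).comp (A x)).flip) x :=
    (ContinuousLinearMap.flipₗᵢ ℝ P' P ℝ).contDiff.contDiffAt.comp x (hB.clm_comp hA)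
  exact (ContinuousLinearMap.flipₗᵢ ℝ P' P' ℝ).contDiff.contDiffAt.comp x (h1.clm_comp hA)

theorem ContDiffAt.koszulForm {m n : WithTop ℕ∞} {Q : Type*} [NormedAddCommGroup Q]
    [NormedSpace ℝ Q] {h : P → P →L[ℝ] P →L[ℝ] ℝ} {y v : Q → P} {x : Q}
    (hh : ContDiffAt ℝ n h (y x)) (hmn : m + 1 ≤ n) (hy : ContDiffAt ℝ m y x)
    (hv : ContDiffAt ℝ m v x) :
    ContDiffAt ℝ m (fun x => koszulForm h (y x) (v x)) x := by
  have h1 : ContDiffAt ℝ m (fun x => fderiv ℝ h (y x)) x :=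
    (hh.fderiv_right hmn).comp x hy
  have h2 : ContDiffAt ℝ m (fun x => (fderiv ℝ h (y x)).flip) x :=
    (ContinuousLinearMap.flipₗᵢ ℝ P P (P →L[ℝ] ℝ)).contDiff.contDiffAt.comp x h1
  have h3 : ContDiffAt ℝ m (fun x => ((fderiv ℝ h (y x)).flip (v x)).flip) x :=
    (ContinuousLinearMap.flipₗᵢ ℝ P P ℝ).contDiff.contDiffAt.comp x (h2.clm_apply hv)
  exact ((h1.clm_apply hv).add (h2.clm_apply hv) |>.sub h3).const_smul (2⁻¹ : ℝ)

theorem ContDiffAt.christoffel [CompleteSpace P] {m n : WithTop ℕ∞} {Q : Type*}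
    [NormedAddCommGroup Q]
    [NormedSpace ℝ Q] {h : P → P →L[ℝ] P →L[ℝ] ℝ} {y v : Q → P} {x : Q}
    (hh : ContDiffAt ℝ n h (y x)) (hmn : m + 1 ≤ n) (hinv : (h (y x)).IsInvertible)
    (hy : ContDiffAt ℝ m y x) (hv : ContDiffAt ℝ m v x) :
    ContDiffAt ℝ m (fun x => christoffel h (y x) (v x)) x := by
  have h1 : ContDiffAt ℝ m (fun x => (h (y x)).inverse) x :=
    ContDiffAt.comp (g := ContinuousLinearMap.inverse) (f := fun x => h (y x)) x
      hinv.contDiffAt_map_inverse (ContDiffAt.comp x (hh.of_le (le_self_add.trans hmn)) hy)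
  exact h1.clm_comp (ContDiffAt.koszulForm hh hmn hy hv)

/-- The transformation law of the Christoffel symbols under a change of coordinates `τ`. -/
theorem christoffel_transform {h₁ : P' → P' →L[ℝ] P' →L[ℝ] ℝ} {h₂ : P → P →L[ℝ] P →L[ℝ] ℝ}
    {τ : P' → P} {y : P'} (hτ : ContDiffAt ℝ 2 τ y) (hh₁ : DifferentiableAt ℝ h₁ y)
    (hh₂ : DifferentiableAt ℝ h₂ (τ y)) (hs : ∀ v w, h₂ (τ y) v w = h₂ (τ y) w v)
    (heq : ∀ᶠ x in 𝓝 y, h₁ x = restrictForm (h₂ (τ x)) (fderiv ℝ τ x))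
    (hinv₁ : (h₁ y).IsInvertible) (hinv₂ : (h₂ (τ y)).IsInvertible)
    (hsurj : Function.Surjective (fderiv ℝ τ y)) (v w : P') :
    fderiv ℝ τ y (christoffel h₁ y v w) =
      fderiv ℝ (fderiv ℝ τ) y v w + christoffel h₂ (τ y) (fderiv ℝ τ y v) (fderiv ℝ τ y w) := by
  have hA : DifferentiableAt ℝ (fderiv ℝ τ) y :=
    (hτ.fderiv_right (m := 1) (by norm_num)).differentiableAt one_ne_zero
  have hτd : DifferentiableAt ℝ τ y := hτ.differentiableAt two_ne_zero
  have hsymm : ∀ a b, fderiv ℝ (fderiv ℝ τ) y a b = fderiv ℝ (fderiv ℝ τ) y b a := fun a b =>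
    (hτ.isSymmSndFDerivAt (by simp)).eq a b
  -- Differentiating `heq` gives the derivative of the transformed metric plus two terms in the
  -- second derivative of `τ`. In the Koszul combination the symmetry of that second derivative
  -- leaves a single such term.
  have key : ∀ a b c, fderiv ℝ h₁ y a b c =
      fderiv ℝ h₂ (τ y) (fderiv ℝ τ y a) (fderiv ℝ τ y b) (fderiv ℝ τ y c)
      + h₂ (τ y) (fderiv ℝ (fderiv ℝ τ) y a b) (fderiv ℝ τ y c)
      + h₂ (τ y) (fderiv ℝ τ y b) (fderiv ℝ (fderiv ℝ τ) y a c) := by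
    intro a b c
    rw [← fderiv_bilin_apply_const hh₁]
    have : (fun x => h₁ x b c) =ᶠ[𝓝 y]
        fun x => (h₂ ∘ τ) x (fderiv ℝ τ x b) (fderiv ℝ τ x c) := by
      filter_upwards [heq] with x hx
      rw [hx]; rfl
    rw [this.fderiv_eq, fderiv_bilin_apply (hh₂.comp y hτd) (hA.clm_apply (by fun_prop))
      (hA.clm_apply (by fun_prop)), fderiv_comp y hh₂ hτd,
      fderiv_clm_apply hA (by fun_prop), fderiv_clm_apply hA (by fun_prop)]
    simp
  refine IsInvertible.apply_ext hinv₂ fun z => ?_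
  -- Surjectivity of the differential makes its values sufficient as test vectors, so that `h₁` can
  -- be substituted for `h₂`.
  obtain ⟨z, rfl⟩ := hsurj z
  have h1 : h₂ (τ y) (fderiv ℝ τ y (christoffel h₁ y v w)) (fderiv ℝ τ y z) =
      h₁ y (christoffel h₁ y v w) z := by
    rw [heq.self_of_nhds]; rfl
  rw [h1, apply_christoffel _ _ hinv₁, map_add, add_apply, apply_christoffel _ _ hinv₂,
    koszulForm_apply, koszulForm_apply, key, key, key, hsymm w v, hsymm z v, hsymm z w,
    hs (fderiv ℝ (fderiv ℝ τ) y v z), hs (fderiv ℝ τ y v)]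
  ring

end BilinearForms

/-! ### The Sasaki metric in natural coordinates and its first derivative. -/

section SasakiForm

open Filter Topology

variable {P : Type*} [NormedAddCommGroup P] [NormedSpace ℝ P]

theorem christoffel_congr {h₁ h₂ : P → P →L[ℝ] P →L[ℝ] ℝ} {y : P} (h : h₁ =ᶠ[𝓝 y] h₂) (v : P) :
    christoffel h₁ y v = christoffel h₂ y v := by
  unfold christoffel koszulForm
  rw [h.fderiv_eq, h.self_of_nhds]

/-- Homogeneity in `v` is not automatic: `christoffel` is bundled as a linear map only in its last
argument. -/
theorem christoffel_smul_smul (h : P → P →L[ℝ] P →L[ℝ] ℝ) (y v w : P) (a b : ℝ) :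
    christoffel h y (a • v) (b • w) = (a * b) • christoffel h y v w := by
  have : koszulForm h y (a • v) = a • koszulForm h y v := by
    ext w z
    simp [koszulForm_apply]
    ring
  simp [christoffel, this, smul_smul, mul_comm]

/-- The Sasaki metric in the natural coordinates of the tangent bundle. -/
def sasakiForm (g : P → P →L[ℝ] P →L[ℝ] ℝ) (p : P × P) : P × P →L[ℝ] P × P →L[ℝ] ℝ :=
  restrictForm (g p.1) (ContinuousLinearMap.fst ℝ P P) +
    restrictForm (g p.1) (ContinuousLinearMap.snd ℝ P P +
      (christoffel g p.1 p.2).comp (ContinuousLinearMap.fst ℝ P P))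

theorem sasakiForm_apply (g : P → P →L[ℝ] P →L[ℝ] ℝ) (p X Y : P × P) :
    sasakiForm g p X Y = g p.1 X.1 Y.1 +
      g p.1 (X.2 + christoffel g p.1 p.2 X.1) (Y.2 + christoffel g p.1 p.2 Y.1) := rfl

theorem sasakiForm_pos {g : P → P →L[ℝ] P →L[ℝ] ℝ} {p : P × P}
    (hg : ∀ v, v ≠ 0 → 0 < g p.1 v v) {X : P × P} (hX : X ≠ 0) : 0 < sasakiForm g p X X := by
  have hnn : ∀ v, 0 ≤ g p.1 v v := fun v => by
    rcases eq_or_ne v 0 with rfl | hv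
    · simp
    · exact (hg v hv).le
  rw [sasakiForm_apply]
  by_cases h1 : X.1 = 0
  · have h2 : X.2 ≠ 0 := fun h2 => hX (Prod.ext h1 h2)
    simpa [h1] using hg _ h2
  · exact add_pos_of_pos_of_nonneg (hg _ h1) (hnn _)

theorem fderiv_comp_fst_apply {F Q : Type*} [NormedAddCommGroup F] [NormedSpace ℝ F]
    [NormedAddCommGroup Q] [NormedSpace ℝ Q] {g : P → F} {p : P × Q}
    (hg : DifferentiableAt ℝ g p.1) (Z : P × Q) :
    fderiv ℝ (fun p : P × Q => g p.1) p Z = fderiv ℝ g p.1 Z.1 := by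
  have h : HasFDerivAt (fun p : P × Q => g p.1) _ p := hg.hasFDerivAt.comp p hasFDerivAt_fst
  rw [h.fderiv]
  rfl

variable [CompleteSpace P]

theorem contDiffAt_sasakiForm {g : P → P →L[ℝ] P →L[ℝ] ℝ} {p : P × P}
    (hg : ContDiffAt ℝ 2 g p.1) (hinv : (g p.1).IsInvertible) :
    ContDiffAt ℝ 1 (sasakiForm g) p := by
  have h1 : ContDiffAt ℝ 1 (fun p : P × P => g p.1) p :=
    ContDiffAt.comp p (hg.of_le one_le_two) contDiffAt_fst
  have h2 : ContDiffAt ℝ 1 (fun p : P × P => christoffel g p.1 p.2) p :=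
    ContDiffAt.christoffel hg (by norm_num) hinv contDiffAt_fst contDiffAt_snd
  exact (ContDiffAt.restrictForm h1 contDiffAt_const).add
    (ContDiffAt.restrictForm h1 (contDiffAt_const.add (h2.clm_comp contDiffAt_const)))

theorem fderiv_sasakiForm {g : P → P →L[ℝ] P →L[ℝ] ℝ} {p : P × P}
    (hg : ContDiffAt ℝ 2 g p.1) (hinv : (g p.1).IsInvertible) (Z V U : P × P) :
    fderiv ℝ (sasakiForm g) p Z V U = fderiv ℝ g p.1 Z.1 V.1 U.1 +
      (fderiv ℝ g p.1 Z.1 (V.2 + christoffel g p.1 p.2 V.1) (U.2 + christoffel g p.1 p.2 U.1) +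
      g p.1 (fderiv ℝ (fun p : P × P => christoffel g p.1 p.2 V.1) p Z)
        (U.2 + christoffel g p.1 p.2 U.1) +
      g p.1 (V.2 + christoffel g p.1 p.2 V.1)
        (fderiv ℝ (fun p : P × P => christoffel g p.1 p.2 U.1) p Z)) := by
  have hgd : DifferentiableAt ℝ g p.1 := hg.differentiableAt two_ne_zero
  have h1 : DifferentiableAt ℝ (fun p : P × P => g p.1) p := by fun_prop
  have hD := fderiv_comp_fst_apply hgd
  have h2 : DifferentiableAt ℝ (fun p : P × P => christoffel g p.1 p.2) p :=
    (ContDiffAt.christoffel (m := 1) hg (by norm_num) hinv contDiffAt_fst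
      contDiffAt_snd).differentiableAt one_ne_zero
  rw [← fderiv_bilin_apply_const
    ((contDiffAt_sasakiForm hg hinv).differentiableAt one_ne_zero)]
  simp_rw [sasakiForm_apply]
  rw [fderiv_fun_add (by fun_prop) (by fun_prop), add_apply, fderiv_bilin_apply_const h1,
    fderiv_bilin_apply h1 (by fun_prop) (by fun_prop), hD, fderiv_const_add, fderiv_const_add]

/-- Differentiating `g(Γ(ξ, a), b) = koszulForm g ξ a b` expresses the derivative of `Γ` by second
derivatives of `g`, without differentiating the inverse metric. Invertibility is required on a
neighbourhood, since the identity is differentiated. -/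
theorem apply_fderiv_christoffel {g : P → P →L[ℝ] P →L[ℝ] ℝ} {p : P × P}
    (hg : ContDiffAt ℝ 2 g p.1) (hinv : ∀ᶠ x in 𝓝 p.1, (g x).IsInvertible) (a b : P) (Z : P × P) :
    g p.1 (fderiv ℝ (fun p : P × P => christoffel g p.1 p.2 a) p Z) b =
      2⁻¹ * (fderiv ℝ (fderiv ℝ g) p.1 Z.1 p.2 a b + fderiv ℝ (fderiv ℝ g) p.1 Z.1 a p.2 b -
        fderiv ℝ (fderiv ℝ g) p.1 Z.1 b p.2 a) + koszulForm g p.1 Z.2 a b -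
      fderiv ℝ g p.1 Z.1 (christoffel g p.1 p.2 a) b := by
  have hgd : DifferentiableAt ℝ g p.1 := hg.differentiableAt two_ne_zero
  have hg2 : DifferentiableAt ℝ (fderiv ℝ g) p.1 :=
    (hg.fderiv_right (m := 1) (by norm_num)).differentiableAt one_ne_zero
  have h1 : DifferentiableAt ℝ (fun p : P × P => g p.1) p := by fun_prop
  have hD := fderiv_comp_fst_apply hgd
  have h2 : DifferentiableAt ℝ (fun p : P × P => christoffel g p.1 p.2) p :=
    (ContDiffAt.christoffel (m := 1) hg (by norm_num) hinv.self_of_nhds contDiffAt_fst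
      contDiffAt_snd).differentiableAt one_ne_zero
  have h := fderiv_bilin_apply (a := fun p : P × P => christoffel g p.1 p.2 a) (b := fun _ => b) h1
    (by fun_prop) (by fun_prop) Z
  have heq : (fun p : P × P => g p.1 (christoffel g p.1 p.2 a) b) =ᶠ[𝓝 p]
      fun p => 2⁻¹ * (fderiv ℝ g p.1 p.2 a b + fderiv ℝ g p.1 a p.2 b - fderiv ℝ g p.1 b p.2 a) := by
    filter_upwards [continuousAt_fst.eventually hinv] with q hq
    rw [apply_christoffel _ _ hq, koszulForm_apply]
  have hB : HasFDerivAt (fun p : P × P => fderiv ℝ g p.1)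
      ((fderiv ℝ (fderiv ℝ g) p.1).comp (ContinuousLinearMap.fst ℝ P P)) p :=
    hg2.hasFDerivAt.comp p hasFDerivAt_fst
  have hs : HasFDerivAt (fun p : P × P => p.2) (ContinuousLinearMap.snd ℝ P P) p := hasFDerivAt_snd
  have hc : ∀ c : P, HasFDerivAt (fun _ : P × P => c) (0 : P × P →L[ℝ] P) p :=
    fun c => hasFDerivAt_const c p
  have h3 := ((((hB.clm_apply hs).clm_apply (hc a)).clm_apply (hc b)).add
    (((hB.clm_apply (hc a)).clm_apply hs).clm_apply (hc b)) |>.sub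
    (((hB.clm_apply (hc b)).clm_apply hs).clm_apply (hc a))).const_mul (2⁻¹ : ℝ)
  rw [heq.fderiv_eq] at h
  erw [h3.fderiv] at h
  rw [hD] at h
  simp at h
  rw [koszulForm_apply]
  linarith

end SasakiForm

/-! ### Total geodesy of the cylinder in coordinates. -/

section SurfaceInChart

open Filter Topology

variable {P : Type*} [NormedAddCommGroup P] [NormedSpace ℝ P]

theorem deriv_bilin_apply {B : ℝ → P →L[ℝ] P →L[ℝ] ℝ} {a b : ℝ → P} {s : ℝ}
    (hB : DifferentiableAt ℝ B s) (ha : DifferentiableAt ℝ a s) (hb : DifferentiableAt ℝ b s) :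
    deriv (fun x => B x (a x) (b x)) s =
      deriv B s (a s) (b s) + B s (deriv a s) (b s) + B s (a s) (deriv b s) :=
  fderiv_bilin_apply hB ha hb 1

theorem hasFDerivAt_mul_fst {ρ : ℝ → ℝ} {q : ℝ × ℝ} (hρ : DifferentiableAt ℝ ρ q.1) :
    HasFDerivAt (fun q : ℝ × ℝ => q.2 * ρ q.1)
      (ρ q.1 • ContinuousLinearMap.snd ℝ ℝ ℝ + (q.2 * deriv ρ q.1) • ContinuousLinearMap.fst ℝ ℝ ℝ)
      q := by
  have h1 : HasFDerivAt (fun q : ℝ × ℝ => ρ q.1) (deriv ρ q.1 • ContinuousLinearMap.fst ℝ ℝ ℝ) q :=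
    hρ.hasDerivAt.comp_hasFDerivAt q hasFDerivAt_fst
  have h2 : HasFDerivAt (fun q : ℝ × ℝ => q.2) (ContinuousLinearMap.snd ℝ ℝ ℝ) q := hasFDerivAt_snd
  refine (h2.mul h1).congr_fderiv ?_
  ext <;> simp

/-- The cylinder-type surface in coordinates. -/
def coordCylinder (y e : ℝ → P) (ρ : ℝ → ℝ) (q : ℝ × ℝ) : P × P :=
  (y q.1, (q.2 * ρ q.1) • e q.1)

theorem fderiv_coordCylinder {y e : ℝ → P} {ρ : ℝ → ℝ} {q : ℝ × ℝ}
    (hy : DifferentiableAt ℝ y q.1) (he : DifferentiableAt ℝ e q.1)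
    (hρ : DifferentiableAt ℝ ρ q.1) (v : ℝ × ℝ) :
    fderiv ℝ (coordCylinder y e ρ) q v = (v.1 • deriv y q.1,
      (v.2 * ρ q.1 + q.2 * deriv ρ q.1 * v.1) • e q.1 + (q.2 * ρ q.1 * v.1) • deriv e q.1) := by
  have h1 : HasFDerivAt (fun q : ℝ × ℝ => y q.1) _ q :=
    hy.hasDerivAt.hasFDerivAt.comp q hasFDerivAt_fst
  have h2 : HasFDerivAt (fun q : ℝ × ℝ => e q.1) _ q :=
    he.hasDerivAt.hasFDerivAt.comp q hasFDerivAt_fst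
  have h3 := h1.prodMk ((hasFDerivAt_mul_fst hρ).smul h2)
  have h4 : HasFDerivAt (coordCylinder y e ρ) _ q := h3
  rw [h4.fderiv]
  simp [smul_smul, mul_comm]
  rw [add_comm, mul_comm]

theorem contDiffAt_coordCylinder {n : WithTop ℕ∞} {y e : ℝ → P} {ρ : ℝ → ℝ} {q : ℝ × ℝ}
    (hy : ContDiffAt ℝ n y q.1) (he : ContDiffAt ℝ n e q.1)
    (hρ : ContDiffAt ℝ n ρ q.1) : ContDiffAt ℝ n (coordCylinder y e ρ) q :=
  (hy.comp q contDiffAt_fst).prodMk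
    ((contDiffAt_snd.mul (hρ.comp q contDiffAt_fst)).smul (he.comp q contDiffAt_fst))

/-- The function has the form of the Sasaki product of `∂ᵥ f` with a fixed vector, for which `σ`
will be the derivative of `ρ`. -/
theorem fderiv_mul_fst_add_mul {ρ σ a b d : ℝ → ℝ} {p : ℝ × ℝ} (hρ : DifferentiableAt ℝ ρ p.1)
    (hσ : DifferentiableAt ℝ σ p.1) (ha : DifferentiableAt ℝ a p.1)
    (hb : DifferentiableAt ℝ b p.1) (hd : DifferentiableAt ℝ d p.1) (v u : ℝ × ℝ) :
    fderiv ℝ (fun q : ℝ × ℝ => v.1 * a q.1 + (v.2 * ρ q.1 + q.2 * σ q.1 * v.1) *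
        (b q.1 + q.2 * ρ q.1 * d q.1)) p u =
      v.1 * u.1 * deriv a p.1 +
      (v.2 * u.1 * deriv ρ p.1 + u.2 * v.1 * σ p.1 + p.2 * u.1 * v.1 * deriv σ p.1) *
        (b p.1 + p.2 * ρ p.1 * d p.1) +
      (v.2 * ρ p.1 + p.2 * σ p.1 * v.1) * (u.1 * deriv b p.1 +
        (u.2 * ρ p.1 + p.2 * deriv ρ p.1 * u.1) * d p.1 + p.2 * ρ p.1 * u.1 * deriv d p.1) := by
  have hf : ∀ {k : ℝ → ℝ}, DifferentiableAt ℝ k p.1 → HasFDerivAt (fun q : ℝ × ℝ => k q.1)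
      (deriv k p.1 • ContinuousLinearMap.fst ℝ ℝ ℝ) p :=
    fun hk => hk.hasDerivAt.comp_hasFDerivAt p hasFDerivAt_fst
  have h := ((hf ha).const_mul v.1).add ((((hf hρ).const_mul v.2).add
    ((hasFDerivAt_mul_fst hσ).mul_const v.1)).mul
      ((hf hb).add ((hasFDerivAt_mul_fst hρ).mul (hf hd))))
  have h' : HasFDerivAt (fun q : ℝ × ℝ => v.1 * a q.1 + (v.2 * ρ q.1 + q.2 * σ q.1 * v.1) *
        (b q.1 + q.2 * ρ q.1 * d q.1)) _ p := h
  rw [h'.fderiv]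
  simp
  ring

variable [CompleteSpace P]

/-- A cylinder-type surface over a geodesic and a parallel field is totally geodesic for the
Sasaki metric in coordinates. -/
theorem exists_covDeriv_coordCylinder_eq {g : P → P →L[ℝ] P →L[ℝ] ℝ} {y e : ℝ → P} {ρ : ℝ → ℝ}
    {p : ℝ × ℝ}
    (hg : ContDiffAt ℝ 2 g (y p.1)) (hs : ∀ᶠ x in 𝓝 (y p.1), ∀ v w, g x v w = g x w v)
    (hinv : ∀ᶠ x in 𝓝 (y p.1), (g x).IsInvertible)
    (hy : ContDiffAt ℝ 2 y p.1) (he : ContDiffAt ℝ 2 e p.1) (hρ : ContDiffAt ℝ 2 ρ p.1)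
    (hgeo : deriv (deriv y) p.1 + christoffel g (y p.1) (deriv y p.1) (deriv y p.1) = 0)
    (hpar : ∀ᶠ s in 𝓝 p.1, deriv e s + christoffel g (y s) (e s) (deriv y s) = 0)
    (hsas : (sasakiForm g (coordCylinder y e ρ p)).IsInvertible) (hρ0 : ρ p.1 ≠ 0)
    (u v : ℝ × ℝ) :
    ∃ w, fderiv ℝ (fun q => fderiv ℝ (coordCylinder y e ρ) q v) p u +
      christoffel (sasakiForm g) (coordCylinder y e ρ p) (fderiv ℝ (coordCylinder y e ρ) p v)
        (fderiv ℝ (coordCylinder y e ρ) p u) = fderiv ℝ (coordCylinder y e ρ) p w := by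
  set f := coordCylinder y e ρ with hf
  have hgd : DifferentiableAt ℝ g (y p.1) := hg.differentiableAt two_ne_zero
  have hgev : ∀ᶠ x in 𝓝 (y p.1), DifferentiableAt ℝ g x :=
    (hg.eventually (by simp)).mono fun x h => h.differentiableAt two_ne_zero
  have hg2 : DifferentiableAt ℝ (fderiv ℝ g) (y p.1) :=
    (hg.fderiv_right (m := 1) (by norm_num)).differentiableAt one_ne_zero
  have hyd : DifferentiableAt ℝ y p.1 := hy.differentiableAt two_ne_zero
  have hed : DifferentiableAt ℝ e p.1 := he.differentiableAt two_ne_zero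
  have hρd : DifferentiableAt ℝ ρ p.1 := hρ.differentiableAt two_ne_zero
  have hy2 : DifferentiableAt ℝ (deriv y) p.1 :=
    ((hy.fderiv_right (m := 1) (by norm_num)).clm_apply contDiffAt_const).differentiableAt
      one_ne_zero
  have hρ2 : DifferentiableAt ℝ (deriv ρ) p.1 :=
    ((hρ.fderiv_right (m := 1) (by norm_num)).clm_apply contDiffAt_const).differentiableAt
      one_ne_zero
  have hf2 : ContDiffAt ℝ 2 f p := contDiffAt_coordCylinder hy he hρ
  have hfd : DifferentiableAt ℝ f p := hf2.differentiableAt two_ne_zero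
  have hDf : DifferentiableAt ℝ (fderiv ℝ f) p :=
    (hf2.fderiv_right (m := 1) (by norm_num)).differentiableAt one_ne_zero
  have hinv0 := hinv.self_of_nhds
  have hS : DifferentiableAt ℝ (sasakiForm g) (f p) :=
    (contDiffAt_sasakiForm (p := f p) hg hinv0).differentiableAt one_ne_zero
  -- Symmetry of the second derivative of `f` will allow the product rule to be averaged over the
  -- two orders of `u` and `v`.
  have hsymmf : ∀ a b, fderiv ℝ (fun q => fderiv ℝ f q a) p b =
      fderiv ℝ (fun q => fderiv ℝ f q b) p a := fun a b => by
    rw [fderiv_clm_apply hDf (by fun_prop), fderiv_clm_apply hDf (by fun_prop)]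
    simpa using (hf2.isSymmSndFDerivAt (by simp)).eq b a
  -- values of the metric on the surface
  have hval : ∀ᶠ q in 𝓝 p, ∀ v Z, sasakiForm g (f q) (fderiv ℝ f q v) Z =
      v.1 * g (y q.1) (deriv y q.1) Z.1 + (v.2 * ρ q.1 + q.2 * deriv ρ q.1 * v.1) *
        (g (y q.1) (e q.1) Z.2 + q.2 * ρ q.1 * (2⁻¹ * fderiv ℝ g (y q.1) Z.1 (e q.1) (e q.1))) := by
    have hev : ∀ᶠ s in 𝓝 p.1, DifferentiableAt ℝ y s ∧ DifferentiableAt ℝ e s ∧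
        DifferentiableAt ℝ ρ s :=
      ((hy.eventually (by simp)).and ((he.eventually (by simp)).and
        (hρ.eventually (by simp)))).mono fun s h => ⟨h.1.differentiableAt two_ne_zero,
          h.2.1.differentiableAt two_ne_zero, h.2.2.differentiableAt two_ne_zero⟩
    have hyc := hyd.continuousAt.eventually (hs.eventually_nhds.and (hinv.and hgev))
    filter_upwards [continuousAt_fst.eventually (hev.and (hpar.and hyc))] with q hq v Z
    obtain ⟨⟨h1, h2, h3⟩, h4, h5, h6, h7⟩ := hq
    rw [hf, fderiv_coordCylinder h1 h2 h3, sasakiForm_apply]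
    simp only [coordCylinder]
    have h8 := christoffel_smul_smul g (y q.1) (e q.1) (deriv y q.1) (q.2 * ρ q.1) v.1
    have h9 := christoffel_smul_smul g (y q.1) (e q.1) Z.1 (q.2 * ρ q.1) 1
    rw [one_smul, mul_one] at h9
    -- The parallel equation cancels the `e'` part of `∂ᵥ f` against its Christoffel term, leaving a
    -- multiple of `e`.
    rw [h8, h9, eq_neg_of_add_eq_zero_left h4]
    simp only [smul_neg, neg_add_cancel_right, map_add, map_smul, smul_apply, smul_eq_mul]
    -- Here `g(e, Γ(e, Z₁))` becomes half the derivative of `g` along `Z₁`, evaluated at `(e, e)`.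
    rw [h5.self_of_nhds (e q.1) (christoffel g (y q.1) (e q.1) Z.1), apply_christoffel _ _ h6,
      koszulForm_apply, fderiv_symm_of_eventually h7 h5 (e q.1) Z.1]
    ring
  have hprod : ∀ v u Z, fderiv ℝ (fun q => sasakiForm g (f q) (fderiv ℝ f q v) Z) p u =
      fderiv ℝ (sasakiForm g) (f p) (fderiv ℝ f p u) (fderiv ℝ f p v) Z +
      sasakiForm g (f p) (fderiv ℝ (fun q => fderiv ℝ f q v) p u) Z := fun v u Z => by
    have h := fderiv_bilin_apply (B := sasakiForm g ∘ f) (a := fun q => fderiv ℝ f q v)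
      (b := fun _ => Z) (hS.comp p hfd) (hDf.clm_apply (by fun_prop)) (by fun_prop) u
    rw [fderiv_comp p hS hfd] at h
    simpa using h
  -- derivatives of the coefficient functions
  have hgy : DifferentiableAt ℝ (fun s => g (y s)) p.1 := hgd.comp p.1 hyd
  have hgyD : deriv (fun s => g (y s)) p.1 = fderiv ℝ g (y p.1) (deriv y p.1) :=
    fderiv_comp_deriv p.1 hgd hyd
  have hg1y : ∀ a, DifferentiableAt ℝ (fun s => fderiv ℝ g (y s) a) p.1 := fun a =>
    (hg2.comp p.1 hyd).clm_apply (by fun_prop)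
  have hg1yD : ∀ a, deriv (fun s => fderiv ℝ g (y s) a) p.1 =
      fderiv ℝ (fderiv ℝ g) (y p.1) (deriv y p.1) a := fun a => by
    have h : HasDerivAt (fun s => fderiv ℝ g (y s)) _ p.1 :=
      hg2.hasFDerivAt.comp_hasDerivAt p.1 hyd.hasDerivAt
    have h' := h.clm_apply (hasDerivAt_const p.1 a)
    rw [h'.deriv]
    simp
  have hsy := hs.self_of_nhds
  have hDsymm := fun u v w => fderiv_symm_of_eventually hgd hs u v w
  have hgeo' := eq_neg_of_add_eq_zero_left hgeo
  have hpar' := eq_neg_of_add_eq_zero_left hpar.self_of_nhds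
  have hneg : ∀ (B : P →L[ℝ] P →L[ℝ] ℝ) (v w : P), B (-v) w = -B v w := by simp
  have hneg' : ∀ (B : P →L[ℝ] P →L[ℝ] ℝ) (v w : P), B v (-w) = -B v w := by simp
  -- The geodesic equation enters only here. The result cancels the horizontal part of the Koszul
  -- term containing the derivative of the metric along `Z`.
  have ha : ∀ z, deriv (fun s => g (y s) (deriv y s) z) p.1 =
      2⁻¹ * fderiv ℝ g (y p.1) z (deriv y p.1) (deriv y p.1) := fun z => by
    rw [deriv_bilin_apply hgy hy2 (by fun_prop), hgyD, hgeo', hneg,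
      apply_christoffel _ _ hinv0, koszulForm_apply]
    simp
    ring
  have hb : ∀ z, deriv (fun s => g (y s) (e s) z) p.1 =
      koszulForm g (y p.1) z (deriv y p.1) (e p.1) := fun z => by
    rw [deriv_bilin_apply hgy hed (by fun_prop), hgyD, hpar', hneg,
      apply_christoffel _ _ hinv0, koszulForm_apply, koszulForm_apply, hDsymm _ z (e p.1),
      hDsymm z (e p.1), hDsymm _ z (deriv y p.1)]
    simp
    ring
  have hd : ∀ z, deriv (fun s => 2⁻¹ * fderiv ℝ g (y s) z (e s) (e s)) p.1 =
      2⁻¹ * fderiv ℝ (fderiv ℝ g) (y p.1) (deriv y p.1) z (e p.1) (e p.1) -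
        fderiv ℝ g (y p.1) z (christoffel g (y p.1) (e p.1) (deriv y p.1)) (e p.1) := fun z => by
    rw [deriv_const_mul _ (((hg1y z).clm_apply hed).clm_apply hed),
      deriv_bilin_apply (hg1y z) hed hed, hg1yD, hpar', hneg, hneg',
      hDsymm z (e p.1)]
    ring
  -- the covariant derivative of `g(∂ᵥ f, Z)`
  have hA : ∀ v u Z, fderiv ℝ (fun q => sasakiForm g (f q) (fderiv ℝ f q v) Z) p u =
      v.1 * u.1 * deriv (fun s => g (y s) (deriv y s) Z.1) p.1 +
      (v.2 * u.1 * deriv ρ p.1 + u.2 * v.1 * deriv ρ p.1 + p.2 * u.1 * v.1 * deriv (deriv ρ) p.1) *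
        (g (y p.1) (e p.1) Z.2 +
          p.2 * ρ p.1 * (2⁻¹ * fderiv ℝ g (y p.1) Z.1 (e p.1) (e p.1))) +
      (v.2 * ρ p.1 + p.2 * deriv ρ p.1 * v.1) *
        (u.1 * deriv (fun s => g (y s) (e s) Z.2) p.1 +
        (u.2 * ρ p.1 + p.2 * deriv ρ p.1 * u.1) *
          (2⁻¹ * fderiv ℝ g (y p.1) Z.1 (e p.1) (e p.1)) + p.2 * ρ p.1 * u.1 *
            deriv (fun s => 2⁻¹ * fderiv ℝ g (y s) Z.1 (e s) (e s)) p.1) := fun v u Z => by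
    rw [Filter.EventuallyEq.fderiv_eq (hval.mono fun q h => h v Z)]
    exact fderiv_mul_fst_add_mul hρd hρ2
      (a := fun s => g (y s) (deriv y s) Z.1) (b := fun s => g (y s) (e s) Z.2)
      (d := fun s => 2⁻¹ * fderiv ℝ g (y s) Z.1 (e s) (e s))
      ((hgy.clm_apply hy2).clm_apply (by fun_prop)) ((hgy.clm_apply hed).clm_apply (by fun_prop))
      ((((hg1y Z.1).clm_apply hed).clm_apply hed).const_mul _) v u
  have hH1 : ∀ a b, fderiv ℝ (fderiv ℝ g) (y p.1) a b = fderiv ℝ (fderiv ℝ g) (y p.1) b a :=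
    fun a b => (hg.isSymmSndFDerivAt (by simp)).eq a b
  have hH2 : ∀ z a b c, fderiv ℝ (fderiv ℝ g) (y p.1) z a b c =
      fderiv ℝ (fderiv ℝ g) (y p.1) z a c b := fun z a b c => by
    have h1 : ∀ᶠ x in 𝓝 (y p.1), ∀ v w, fderiv ℝ g x a v w = fderiv ℝ g x a w v :=
      (hs.eventually_nhds.and hgev).mono fun x hx => fderiv_symm_of_eventually hx.2 hx.1 a
    have h := fderiv_symm_of_eventually (hg2.clm_apply (by fun_prop)) h1 z b c
    rw [fderiv_clm_apply hg2 (by fun_prop)] at h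
    simpa using h
  -- The geometric core: after both sides are expanded, the difference is a multiple of `g(R(Z₁,
  -- y')e, e)`, which vanishes. In coordinates this is the symmetry of second derivatives of `g`
  -- (`hH1`) and of its two arguments (`hH2`).
  have hG : ∀ Z : P × P,
      g (y p.1) (fderiv ℝ (fun q : P × P => christoffel g q.1 q.2 (deriv y p.1)) (f p) Z) (e p.1) =
      deriv (fun s => g (y s) (e s) Z.2) p.1 + p.2 * ρ p.1 *
        deriv (fun s => 2⁻¹ * fderiv ℝ g (y s) Z.1 (e s) (e s)) p.1 := fun Z => by
    rw [hb, hd]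
    have h := apply_fderiv_christoffel (p := f p) hg hinv (deriv y p.1) (e p.1) Z
    have h9 := christoffel_smul_smul g (y p.1) (e p.1) (deriv y p.1) (p.2 * ρ p.1) 1
    rw [one_smul, mul_one] at h9
    simp only [hf, coordCylinder] at h ⊢
    rw [h9] at h
    simp only [map_smul, smul_apply, smul_eq_mul] at h
    rw [h, hH2 _ _ (e p.1) (deriv y p.1), hH1 (deriv y p.1)]
    ring
  have hchr := christoffel_smul_smul g (y p.1) (e p.1) (deriv y p.1) (p.2 * ρ p.1)
  -- The value of the connection map on `∂ᵥ f`.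
  have hN : ∀ v, (fderiv ℝ f p v).2 + christoffel g (f p).1 (f p).2 (fderiv ℝ f p v).1 =
      (v.2 * ρ p.1 + p.2 * deriv ρ p.1 * v.1) • e p.1 := fun v => by
    rw [hf, fderiv_coordCylinder hyd hed hρd]
    simp only [coordCylinder]
    rw [hchr v.1, hpar']
    simp
  have hX : ∀ v, (fderiv ℝ f p v).1 = v.1 • deriv y p.1 := fun v => by
    rw [hf, fderiv_coordCylinder hyd hed hρd]
  have hGs : ∀ (c : ℝ) (Z : P × P),
      fderiv ℝ (fun q : P × P => christoffel g q.1 q.2 (c • deriv y p.1)) (f p) Z =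
      c • fderiv ℝ (fun q : P × P => christoffel g q.1 q.2 (deriv y p.1)) (f p) Z := fun c Z => by
    have h2 : DifferentiableAt ℝ (fun q : P × P => christoffel g q.1 q.2) (f p) :=
      (ContDiffAt.christoffel (m := 1) (y := Prod.fst) (x := f p) hg (by norm_num) hinv0
        contDiffAt_fst contDiffAt_snd).differentiableAt one_ne_zero
    simp only [map_smul]
    rw [fderiv_fun_const_smul (by fun_prop)]
    rfl
  have hDS : ∀ Z u v, fderiv ℝ (sasakiForm g) (f p) Z (fderiv ℝ f p v) (fderiv ℝ f p u) =
      v.1 * u.1 * fderiv ℝ g (y p.1) Z.1 (deriv y p.1) (deriv y p.1) +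
      (v.2 * ρ p.1 + p.2 * deriv ρ p.1 * v.1) * (u.2 * ρ p.1 + p.2 * deriv ρ p.1 * u.1) *
        fderiv ℝ g (y p.1) Z.1 (e p.1) (e p.1) +
      (v.1 * (u.2 * ρ p.1 + p.2 * deriv ρ p.1 * u.1) +
        u.1 * (v.2 * ρ p.1 + p.2 * deriv ρ p.1 * v.1)) *
          (deriv (fun s => g (y s) (e s) Z.2) p.1 + p.2 * ρ p.1 *
            deriv (fun s => 2⁻¹ * fderiv ℝ g (y s) Z.1 (e s) (e s)) p.1) := fun Z u v => by
    rw [fderiv_sasakiForm (p := f p) hg hinv0, hN, hN, hX, hX, hGs, hGs]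
    simp only [map_smul, smul_apply, smul_eq_mul]
    change _ + (_ + _ * (_ * g (y p.1) _ _) + _ * (_ * g (y p.1) _ _)) = _
    rw [hsy (e p.1), hG]
    simp only [hf, coordCylinder]
    ring
  -- `k` is the Hessian of `tρ` evaluated at `(u, v)`.
  set k := v.2 * u.1 * deriv ρ p.1 + u.2 * v.1 * deriv ρ p.1 +
    p.2 * u.1 * v.1 * deriv (deriv ρ) p.1 with hk
  -- The covariant derivative is the vertical vector `k e`, and `∂ₜ f` is the vertical vector `ρ e`.
  refine ⟨(0, k / ρ p.1), IsInvertible.apply_ext hsas fun Z => ?_⟩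
  rw [map_add, add_apply, apply_christoffel _ _ hsas, koszulForm_apply]
  have h1 := hprod v u Z
  have h2 := hprod u v Z
  rw [hA] at h1 h2
  rw [hsymmf u v] at h2
  rw [hDS Z u v, hval.self_of_nhds]
  have h3 : k / ρ p.1 * ρ p.1 = k := div_mul_cancel₀ _ hρ0
  rw [ha] at h1 h2
  simp only [zero_mul, mul_zero, add_zero, zero_add]
  rw [h3]
  simp only [hf, coordCylinder] at *
  -- Koszul's formula takes half of each of the two product-rule identities; the remaining term, the
  -- derivative along `Z`, was supplied by `hDS`.
  linear_combination (-2⁻¹ : ℝ) * h1 - 2⁻¹ * h2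

end SurfaceInChart

/-! ### Flatness of the metric `a ds² + d(tρ)²`. -/

section FlatSurface

open Filter Topology

/-- The differential of `(s, t) ↦ t ρ(s)`. -/
def mulFstDeriv (ρ : ℝ → ℝ) (q : ℝ × ℝ) : ℝ × ℝ →L[ℝ] ℝ :=
  ρ q.1 • ContinuousLinearMap.snd ℝ ℝ ℝ + (q.2 * deriv ρ q.1) • ContinuousLinearMap.fst ℝ ℝ ℝ

theorem mulFstDeriv_apply (ρ : ℝ → ℝ) (q v : ℝ × ℝ) :
    mulFstDeriv ρ q v = v.2 * ρ q.1 + q.2 * deriv ρ q.1 * v.1 := by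
  simp [mulFstDeriv, mul_comm]

/-- The metric `a ds² + d(tρ)²`. -/
def cylinderForm (a : ℝ) (ρ : ℝ → ℝ) (q : ℝ × ℝ) : ℝ × ℝ →L[ℝ] ℝ × ℝ →L[ℝ] ℝ :=
  a • restrictForm (ContinuousLinearMap.mul ℝ ℝ) (ContinuousLinearMap.fst ℝ ℝ ℝ) +
    restrictForm (ContinuousLinearMap.mul ℝ ℝ) (mulFstDeriv ρ q)

theorem cylinderForm_apply (a : ℝ) (ρ : ℝ → ℝ) (q v w : ℝ × ℝ) :
    cylinderForm a ρ q v w = a * (v.1 * w.1) + mulFstDeriv ρ q v * mulFstDeriv ρ q w := rfl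

theorem isInvertible_cylinderForm {a : ℝ} (ha : 0 < a) {ρ : ℝ → ℝ} {q : ℝ × ℝ} (hρ : ρ q.1 ≠ 0) :
    (cylinderForm a ρ q).IsInvertible := by
  refine isInvertible_of_posDef fun v hv => ?_
  rw [cylinderForm_apply]
  by_cases h1 : v.1 = 0
  · have h2 : v.2 ≠ 0 := fun h2 => hv (Prod.ext h1 h2)
    have : mulFstDeriv ρ q v ≠ 0 := by simp [mulFstDeriv_apply, h1, h2, hρ]
    simpa [h1] using mul_self_pos.2 this
  · exact add_pos_of_pos_of_nonneg (mul_pos ha (mul_self_pos.2 h1)) (mul_self_nonneg _)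

theorem hasFDerivAt_mulFstDeriv {ρ : ℝ → ℝ} {q : ℝ × ℝ} (h1 : DifferentiableAt ℝ ρ q.1)
    (h2 : DifferentiableAt ℝ (deriv ρ) q.1) (v : ℝ × ℝ) :
    HasFDerivAt (fun q => mulFstDeriv ρ q v)
      ((v.2 * deriv ρ q.1 + v.1 * q.2 * deriv (deriv ρ) q.1) • ContinuousLinearMap.fst ℝ ℝ ℝ +
        (v.1 * deriv ρ q.1) • ContinuousLinearMap.snd ℝ ℝ ℝ) q := by
  have h3 : HasFDerivAt (fun q : ℝ × ℝ => ρ q.1) (deriv ρ q.1 • ContinuousLinearMap.fst ℝ ℝ ℝ) q :=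
    h1.hasDerivAt.comp_hasFDerivAt q hasFDerivAt_fst
  simp_rw [mulFstDeriv_apply]
  refine ((h3.const_mul v.2).add ((hasFDerivAt_mul_fst h2).mul_const v.1)).congr_fderiv ?_
  ext <;> simp
  ring

theorem differentiableAt_cylinderForm {a : ℝ} {ρ : ℝ → ℝ} {q : ℝ × ℝ} (h : ContDiffAt ℝ 2 ρ q.1) :
    DifferentiableAt ℝ (cylinderForm a ρ) q := by
  have h1 : ContDiffAt ℝ 1 (fun q : ℝ × ℝ => ρ q.1) q :=
    (h.of_le one_le_two).comp q contDiffAt_fst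
  have h2 : ContDiffAt ℝ 1 (fun q : ℝ × ℝ => deriv ρ q.1) q :=
    ((h.fderiv_right (m := 1) (by norm_num)).clm_apply contDiffAt_const).comp q contDiffAt_fst
  exact (contDiffAt_const.add (ContDiffAt.restrictForm contDiffAt_const
    ((h1.smul contDiffAt_const).add
      ((contDiffAt_snd.mul h2).smul contDiffAt_const)))).differentiableAt one_ne_zero

/-- The metric is constant in the coordinates `(s, tρ)`, so `Γ` is the Hessian of `tρ` divided by
`ρ`, in the direction `∂ₜ`. -/
theorem christoffel_cylinderForm {a : ℝ} (ha : 0 < a) {ρ : ℝ → ℝ} {q : ℝ × ℝ} (hρ : ρ q.1 ≠ 0)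
    (h : ContDiffAt ℝ 2 ρ q.1) (v w : ℝ × ℝ) :
    christoffel (cylinderForm a ρ) q v w =
      (0, q.2 * (v.1 * w.1 * (deriv (deriv ρ) q.1 / ρ q.1)) +
        (v.1 * w.2 + v.2 * w.1) * (deriv ρ q.1 / ρ q.1)) := by
  have hinv := isInvertible_cylinderForm ha hρ
  have h1 : DifferentiableAt ℝ ρ q.1 := h.differentiableAt two_ne_zero
  have h2 : DifferentiableAt ℝ (deriv ρ) q.1 :=
    ((h.fderiv_right (m := 1) (by norm_num)).clm_apply contDiffAt_const).differentiableAt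
      one_ne_zero
  have key : ∀ u v w, fderiv ℝ (cylinderForm a ρ) q u v w =
      (v.2 * u.1 * deriv ρ q.1 + v.1 * u.1 * q.2 * deriv (deriv ρ) q.1 + v.1 * u.2 * deriv ρ q.1) *
        mulFstDeriv ρ q w + mulFstDeriv ρ q v *
      (w.2 * u.1 * deriv ρ q.1 + w.1 * u.1 * q.2 * deriv (deriv ρ) q.1 +
        w.1 * u.2 * deriv ρ q.1) := fun u v w => by
    rw [← fderiv_bilin_apply_const (differentiableAt_cylinderForm h)]
    simp_rw [cylinderForm_apply]
    have h := ((hasFDerivAt_mulFstDeriv h1 h2 v).mul (hasFDerivAt_mulFstDeriv h1 h2 w)).const_add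
      (a * (v.1 * w.1))
    have h' : HasFDerivAt (fun q => a * (v.1 * w.1) + mulFstDeriv ρ q v * mulFstDeriv ρ q w) _ q := h
    rw [h'.fderiv]
    simp
    ring
  refine IsInvertible.apply_ext hinv fun z => ?_
  rw [apply_christoffel _ _ hinv, koszulForm_apply, key, key, key, cylinderForm_apply]
  simp only [mulFstDeriv_apply]
  field_simp
  ring

/-- The metric `a ds² + d(tρ)²` is flat. -/
theorem curvature_eq_zero_of_eventuallyEq_cylinderForm {h : ℝ × ℝ → ℝ × ℝ →L[ℝ] ℝ × ℝ →L[ℝ] ℝ}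
    {a : ℝ} (ha : 0 < a) {ρ : ℝ → ℝ} {p : ℝ × ℝ} (hρ : ContDiffAt ℝ 3 ρ p.1) (hρ0 : ρ p.1 ≠ 0)
    (hh : h =ᶠ[𝓝 p] cylinderForm a ρ) (u v w : ℝ × ℝ) : curvature h p u v w = 0 := by
  have hρ1 : ContDiffAt ℝ 2 (deriv ρ) p.1 :=
    (hρ.fderiv_right (m := 2) (by norm_num)).clm_apply contDiffAt_const
  have hρ2 : ContDiffAt ℝ 1 (deriv (deriv ρ)) p.1 :=
    (hρ1.fderiv_right (m := 1) (by norm_num)).clm_apply contDiffAt_const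
  have hd : DifferentiableAt ℝ ρ p.1 := hρ.differentiableAt three_ne_zero
  have hd1 : DifferentiableAt ℝ (deriv ρ) p.1 := hρ1.differentiableAt two_ne_zero
  have hd2 : DifferentiableAt ℝ (deriv (deriv ρ)) p.1 := hρ2.differentiableAt one_ne_zero
  have hev : ∀ᶠ q in 𝓝 p, ∀ v w, christoffel h q v w =
      (0, q.2 * (v.1 * w.1 * (deriv (deriv ρ) q.1 / ρ q.1)) +
        (v.1 * w.2 + v.2 * w.1) * (deriv ρ q.1 / ρ q.1)) := by
    have h1 : ∀ᶠ s in 𝓝 p.1, ρ s ≠ 0 ∧ ContDiffAt ℝ 2 ρ s :=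
      (hd.continuousAt.eventually_ne hρ0).and
        ((hρ.of_le (by norm_num)).eventually (by simp))
    filter_upwards [continuousAt_fst.eventually h1, hh.eventuallyEq_nhds] with q hq hq' v w
    rw [christoffel_congr hq', christoffel_cylinderForm ha hq.1 hq.2]
  -- The derivative of `ρ''/ρ` stays unevaluated: its coefficient contains `u.1 * v.1`, so it
  -- disappears on antisymmetrising in `u` and `v`.
  have hD : ∀ u v w, fderiv ℝ (fun q => christoffel h q v w) p u =
      (0, v.1 * w.1 * (u.2 * (deriv (deriv ρ) p.1 / ρ p.1) +
        p.2 * deriv (deriv (deriv ρ) / ρ) p.1 * u.1) +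
        (v.1 * w.2 + v.2 * w.1) * ((deriv (deriv ρ) p.1 * ρ p.1 - deriv ρ p.1 * deriv ρ p.1) /
          ρ p.1 ^ 2) * u.1) := fun u v w => by
    rw [Filter.EventuallyEq.fderiv_eq (hev.mono fun q hq => hq v w)]
    have hfst : HasFDerivAt (fun q : ℝ × ℝ => q.1) (ContinuousLinearMap.fst ℝ ℝ ℝ) p :=
      hasFDerivAt_fst
    have h1 : HasFDerivAt (fun q : ℝ × ℝ => deriv ρ q.1 / ρ q.1) _ p :=
      HasDerivAt.comp_hasFDerivAt (h₂ := fun s => deriv ρ s / ρ s) p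
        (hd1.hasDerivAt.div hd.hasDerivAt hρ0) hfst
    have h2 : HasFDerivAt (fun q : ℝ × ℝ => deriv (deriv ρ) q.1 / ρ q.1) _ p :=
      HasDerivAt.comp_hasFDerivAt (h₂ := fun s => deriv (deriv ρ) s / ρ s) p
        (hd2.div hd hρ0).hasDerivAt hfst
    have h3 : HasFDerivAt (fun q : ℝ × ℝ => q.2) (ContinuousLinearMap.snd ℝ ℝ ℝ) p := hasFDerivAt_snd
    have h4 := (hasFDerivAt_const (𝕜 := ℝ) (0 : ℝ) p).prodMk
      ((h3.mul (h2.const_mul (v.1 * w.1))).add (h1.const_mul (v.1 * w.2 + v.2 * w.1)))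
    have h5 : HasFDerivAt (fun q : ℝ × ℝ => ((0 : ℝ),
      q.2 * (v.1 * w.1 * (deriv (deriv ρ) q.1 / ρ q.1)) +
        (v.1 * w.2 + v.2 * w.1) * (deriv ρ q.1 / ρ q.1))) _ p := h4
    rw [h5.fderiv]
    ext
    · simp
    · simp
      ring
  unfold curvature
  rw [hD, hD]
  simp only [hev.self_of_nhds]
  ext
  · simp
  · simp
    field_simp
    ring

end FlatSurface

/-! ### Derivatives and covariant derivatives in preferred charts. -/

section TangentCharts

open Filter Topology

variable {E : Type*} [NormedAddCommGroup E] [NormedSpace ℝ E]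
  {H : Type*} [TopologicalSpace H] {I : ModelWithCorners ℝ E H}
  {N : Type*} [TopologicalSpace N] [ChartedSpace H N]
  {P : Type*} [NormedAddCommGroup P] [NormedSpace ℝ P]

theorem pullbackMetric_apply (G : BilinField I N) (f : P → N) (p u v : P) :
    pullbackMetric G f p u v = G (f p) (mfderiv 𝓘(ℝ, P) I f p u) (mfderiv 𝓘(ℝ, P) I f p v) := rfl

theorem pullbackMetric_congr (G : BilinField I N) {f f' : P → N} {p : P} (h : f =ᶠ[𝓝 p] f') :
    pullbackMetric G f p = pullbackMetric G f' p := by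
  -- `G (f p)` and `G (f' p)` have different dependent types; regarding both as forms on `E` makes
  -- the rewrite possible.
  have hG : ∀ {x x' : N}, x = x' → (G x : E →L[ℝ] E →L[ℝ] ℝ) = G x' := by
    rintro x _ rfl
    rfl
  ext u v
  have h1 : (mfderiv 𝓘(ℝ, P) I f p : P →L[ℝ] E) = mfderiv 𝓘(ℝ, P) I f' p := h.mfderiv_eq
  change (G (f p) : E →L[ℝ] E →L[ℝ] ℝ) ((mfderiv 𝓘(ℝ, P) I f p : P →L[ℝ] E) u)
    ((mfderiv 𝓘(ℝ, P) I f p : P →L[ℝ] E) v) = _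
  rw [h1, hG h.self_of_nhds]
  rfl

theorem pullbackMetric_comp {P' : Type*} [NormedAddCommGroup P'] [NormedSpace ℝ P']
    (G : BilinField I N) {f : P → N} {τ : P' → P} {y : P'}
    (hf : MDifferentiableAt 𝓘(ℝ, P) I f (τ y)) (hτ : DifferentiableAt ℝ τ y) :
    pullbackMetric G (f ∘ τ) y = restrictForm (pullbackMetric G f (τ y)) (fderiv ℝ τ y) := by
  ext u v
  rw [restrictForm_apply, pullbackMetric_apply, pullbackMetric_apply,
    mfderiv_comp y hf hτ.mdifferentiableAt, mfderiv_eq_fderiv]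
  rfl

section

variable [IsManifold I 1 N]

theorem extChartAt_tangent_apply (Q₀ Q : TangentBundle I N) :
    extChartAt I.tangent Q₀ Q =
      (extChartAt I Q₀.proj Q.proj, tangentCoordChange I Q.proj Q₀.proj Q.proj Q.snd) := rfl

theorem fderiv_fun_prodMk {P₁ P₂ : Type*} [NormedAddCommGroup P₁] [NormedSpace ℝ P₁]
    [NormedAddCommGroup P₂] [NormedSpace ℝ P₂] {a : P → P₁} {b : P → P₂} {p : P}
    (h : DifferentiableAt ℝ (fun q => (a q, b q)) p) (u : P) :
    fderiv ℝ (fun q => (a q, b q)) p u = (fderiv ℝ a p u, fderiv ℝ b p u) := by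
  rw [DifferentiableAt.fderiv_prodMk h.fst h.snd]
  rfl

theorem mfderiv_section_apply {f : P → N} {V : ∀ p : P, TangentSpace I (f p)} {p : P}
    (hQ : MDifferentiableAt 𝓘(ℝ, P) I.tangent (fun q => (⟨f q, V q⟩ : TangentBundle I N)) p)
    (u : P) :
    (mfderiv 𝓘(ℝ, P) I.tangent (fun q => (⟨f q, V q⟩ : TangentBundle I N)) p u : E × E) =
      (fderiv ℝ (fun q => extChartAt I (f p) (f q)) p u,
        fderiv ℝ (fun q => tangentCoordChange I (f q) (f p) (f q) (V q)) p u) := by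
  have hd := hQ.differentiableWithinAt_writtenInExtChartAt
  rw [ModelWithCorners.range_eq_univ, differentiableWithinAt_univ] at hd
  rw [hQ.mfderiv, ModelWithCorners.range_eq_univ, fderivWithin_univ]
  exact fderiv_fun_prodMk hd u

/-- The covariant derivative along a map in the preferred chart of the base point. -/
theorem covDerivAlong_eq (G : BilinField I N) {f : P → N} {V : ∀ p : P, TangentSpace I (f p)}
    {p : P}
    (hQ : MDifferentiableAt 𝓘(ℝ, P) I.tangent (fun q => (⟨f q, V q⟩ : TangentBundle I N)) p)
    (u : P) :
    covDerivAlong G f V p u =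
      (fderiv ℝ (fun q => tangentCoordChange I (f q) (f p) (f q) (V q)) p u +
      christoffel (pullbackMetric G (extChartAt I (f p)).symm) (extChartAt I (f p) (f p)) (V p)
        (fderiv ℝ (fun q => extChartAt I (f p) (f q)) p u) : E) := by
  have h := mfderiv_section_apply hQ u
  have h1 : ∀ X : E × E, connectionMap G (⟨f p, V p⟩ : TangentBundle I N) X =
    (X.2 + christoffelAt G (f p) (V p) X.1 : E) := fun X => rfl
  unfold covDerivAlong
  erw [h1, h]
  rfl

end

end TangentCharts

/-! ### Change of chart for vectors, metrics and covariant derivatives. -/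

section Boundaryless

open Filter Topology

variable {E : Type*} [NormedAddCommGroup E] [NormedSpace ℝ E]
  {H : Type*} [TopologicalSpace H] {I : ModelWithCorners ℝ E H} [I.Boundaryless]
  {N : Type*} [TopologicalSpace N] [ChartedSpace H N]
  {P : Type*} [NormedAddCommGroup P] [NormedSpace ℝ P]

section

variable [IsManifold I 1 N]

theorem hasFDerivAt_tangentCoordChange {x y z : N}
    (h : z ∈ (extChartAt I x).source ∩ (extChartAt I y).source) :
    HasFDerivAt (extChartAt I y ∘ (extChartAt I x).symm) (tangentCoordChange I x y z)
      (extChartAt I x z) := by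
  have h1 := hasFDerivWithinAt_tangentCoordChange h
  rwa [ModelWithCorners.range_eq_univ, hasFDerivWithinAt_univ] at h1

omit [I.Boundaryless] [IsManifold I 1 N] in
theorem differentiableAt_extChartAt_comp {f : P → N} {p : P}
    (hf : MDifferentiableAt 𝓘(ℝ, P) I f p) :
    DifferentiableAt ℝ (fun q => extChartAt I (f p) (f q)) p := by
  have hd := hf.differentiableWithinAt_writtenInExtChartAt
  rwa [ModelWithCorners.range_eq_univ, differentiableWithinAt_univ] at hd

omit [I.Boundaryless] [IsManifold I 1 N] in
theorem mfderiv_apply_eq_fderiv {f : P → N} {p : P} (hf : MDifferentiableAt 𝓘(ℝ, P) I f p) (v : P) :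
    (mfderiv 𝓘(ℝ, P) I f p v : E) = fderiv ℝ (fun q => extChartAt I (f p) (f q)) p v := by
  rw [hf.mfderiv, ModelWithCorners.range_eq_univ, fderivWithin_univ]
  rfl

/-- The chain rule for the transition map from the chart at `f p` to a fixed chart at `x₀`, which
will serve for all nearby points. -/
theorem tangentCoordChange_mfderiv {f : P → N} {p : P} {x₀ : N}
    (hf : MDifferentiableAt 𝓘(ℝ, P) I f p) (hx : f p ∈ (extChartAt I x₀).source) (v : P) :
    tangentCoordChange I (f p) x₀ (f p) (mfderiv 𝓘(ℝ, P) I f p v) =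
      fderiv ℝ (fun q => extChartAt I x₀ (f q)) p v := by
  have h1 := (hasFDerivAt_tangentCoordChange (I := I) (x := f p) (y := x₀) (z := f p)
    ⟨mem_extChartAt_source (I := I) (f p), hx⟩).comp p
    (differentiableAt_extChartAt_comp hf).hasFDerivAt
  have h2 : (fun q => extChartAt I x₀ (f q)) =ᶠ[𝓝 p]
      (extChartAt I x₀ ∘ (extChartAt I (f p)).symm) ∘ fun q => extChartAt I (f p) (f q) := by
    filter_upwards [hf.continuousAt (extChartAt_source_mem_nhds (I := I) (f p))] with q hq
    simp only [Function.comp_apply]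
    rw [(extChartAt I (f p)).left_inv hq]
  rw [(h1.congr_of_eventuallyEq h2).fderiv]
  exact congrArg _ (mfderiv_apply_eq_fderiv hf v)

theorem mdifferentiableAt_extChartAt_symm {x₀ : N} {y : E} (hy : y ∈ (extChartAt I x₀).target) :
    MDifferentiableAt 𝓘(ℝ, E) I (extChartAt I x₀).symm y := by
  have := mdifferentiableWithinAt_extChartAt_symm (I := I) hy
  rwa [ModelWithCorners.range_eq_univ, mdifferentiableWithinAt_univ] at this

theorem mfderiv_extChartAt_symm_apply {x₀ : N} {y : E} (hy : y ∈ (extChartAt I x₀).target) (v : E) :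
    (mfderiv 𝓘(ℝ, E) I (extChartAt I x₀).symm y v : E) =
      tangentCoordChange I x₀ ((extChartAt I x₀).symm y) ((extChartAt I x₀).symm y) v := by
  have h := hasFDerivAt_tangentCoordChange (I := I) (N := N)
    ⟨(extChartAt I x₀).map_target hy, mem_extChartAt_source ((extChartAt I x₀).symm y)⟩
  rw [(extChartAt I x₀).right_inv hy] at h
  refine (mfderiv_apply_eq_fderiv (mdifferentiableAt_extChartAt_symm hy) v).trans ?_
  exact congrArg (fun A : E →L[ℝ] E => A v) h.fderiv

theorem pullbackMetric_extChartAt_symm_apply (G : BilinField I N) {x₀ x : N}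
    (hx : x ∈ (extChartAt I x₀).source) (v w : E) :
    pullbackMetric G (extChartAt I x₀).symm (extChartAt I x₀ x)
      (tangentCoordChange I x x₀ x v) (tangentCoordChange I x x₀ x w) =
      (G x : E →L[ℝ] E →L[ℝ] ℝ) v w := by
  have hy := (extChartAt I x₀).map_source hx
  -- The base point is generalised because the chart inverse returns to `x` only up to a
  -- propositional equality, on which the type of `G x` depends.
  have key : ∀ x', x' = x → ∀ v w : E, (G x' : E →L[ℝ] E →L[ℝ] ℝ)
      (tangentCoordChange I x₀ x' x' (tangentCoordChange I x x₀ x v))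
      (tangentCoordChange I x₀ x' x' (tangentCoordChange I x x₀ x w)) =
      (G x : E →L[ℝ] E →L[ℝ] ℝ) v w := by
    rintro _ rfl v w
    rw [tangentCoordChange_comp ⟨⟨mem_extChartAt_source _, hx⟩, mem_extChartAt_source _⟩,
      tangentCoordChange_comp ⟨⟨mem_extChartAt_source _, hx⟩, mem_extChartAt_source _⟩,
      tangentCoordChange_self (mem_extChartAt_source _),
      tangentCoordChange_self (mem_extChartAt_source _)]
  rw [← key _ ((extChartAt I x₀).left_inv hx) v w, ← mfderiv_extChartAt_symm_apply hy,
    ← mfderiv_extChartAt_symm_apply hy]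
  rfl

omit [I.Boundaryless] in
theorem tangentCoordChange_surjective {x x₀ : N} (hx : x ∈ (extChartAt I x₀).source) :
    Function.Surjective (tangentCoordChange I x x₀ x) := fun v =>
  ⟨tangentCoordChange I x₀ x x v, by
    rw [tangentCoordChange_comp ⟨⟨hx, mem_extChartAt_source _⟩, hx⟩, tangentCoordChange_self hx]⟩

end

/-- A smooth Riemannian metric, as a field of bilinear forms. -/
structure IsSmoothMetric (G : BilinField I N) : Prop where
  symm : ∀ (x : N) (v w : TangentSpace I x), G x v w = G x w v
  pos : ∀ (x : N) (v : TangentSpace I x), v ≠ 0 → 0 < G x v v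
  contDiffAt : ∀ (x₀ : N), ∀ y ∈ (extChartAt I x₀).target,
    ContDiffAt ℝ ∞ (pullbackMetric G (extChartAt I x₀).symm) y

namespace IsSmoothMetric

variable {G : BilinField I N}

omit [I.Boundaryless] in
theorem pullbackMetric_symm (hG : IsSmoothMetric G) (f : P → N) (p v w : P) :
    pullbackMetric G f p v w = pullbackMetric G f p w v := hG.symm _ _ _

variable [IsManifold I 1 N]

/-- Definiteness survives the pull-back because the inverse chart has an injective differential: the
coordinate change has a left inverse. -/
theorem pullbackMetric_pos (hG : IsSmoothMetric G) {x₀ : N} {y : E}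
    (hy : y ∈ (extChartAt I x₀).target) (v : E) (hv : v ≠ 0) :
    0 < pullbackMetric G (extChartAt I x₀).symm y v v := by
  rw [pullbackMetric_apply]
  refine hG.pos _ _ fun h => hv ?_
  have h1 := mfderiv_extChartAt_symm_apply hy v
  have hs := (extChartAt I x₀).map_target hy
  have h2 := tangentCoordChange_comp (I := I) (v := v)
    ⟨⟨hs, mem_extChartAt_source (I := I) ((extChartAt I x₀).symm y)⟩, hs⟩
  rw [tangentCoordChange_self hs, ← h1] at h2
  erw [h, map_zero] at h2
  exact h2.symm

theorem isInvertible [FiniteDimensional ℝ E] (hG : IsSmoothMetric G) {x₀ : N} {y : E}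
    (hy : y ∈ (extChartAt I x₀).target) :
    (pullbackMetric G (extChartAt I x₀).symm y).IsInvertible :=
  isInvertible_of_posDef (hG.pullbackMetric_pos hy)

end IsSmoothMetric

/-- The covariant derivative along a map in an arbitrary preferred chart. -/
theorem tangentCoordChange_covDerivAlong [IsManifold I ∞ N] [FiniteDimensional ℝ E]
    {G : BilinField I N}
    (hG : IsSmoothMetric G) {f : P → N} {V : ∀ p : P, TangentSpace I (f p)} {p : P}
    (hQ : MDifferentiableAt 𝓘(ℝ, P) I.tangent (fun q => (⟨f q, V q⟩ : TangentBundle I N)) p)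
    {x₀ : N} (hx : f p ∈ (extChartAt I x₀).source) (u : P) :
    tangentCoordChange I (f p) x₀ (f p) (covDerivAlong G f V p u) =
      fderiv ℝ (fun q => tangentCoordChange I (f q) x₀ (f q) (V q)) p u +
      christoffel (pullbackMetric G (extChartAt I x₀).symm) (extChartAt I x₀ (f p))
        (tangentCoordChange I (f p) x₀ (f p) (V p))
        (fderiv ℝ (fun q => extChartAt I x₀ (f q)) p u) := by
  set φ₀ := extChartAt I x₀ with hφ₀
  set φ₁ := extChartAt I (f p) with hφ₁
  set τ : E → E := φ₀ ∘ φ₁.symm with hτ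
  have hx₁ : f p ∈ φ₁.source := mem_extChartAt_source (f p)
  have hτ2 : ContDiffAt ℝ 2 τ (φ₁ (f p)) := by
    have h1 : φ₁ (f p) ∈ (φ₁.symm ≫ φ₀).source := by
      rw [PartialEquiv.trans_source'', PartialEquiv.symm_symm, PartialEquiv.symm_target]
      exact mem_image_of_mem _ ⟨hx₁, hx⟩
    have h2 := contDiffWithinAt_ext_coord_change (n := ∞) (I := I) x₀ (f p) h1
    rw [ModelWithCorners.range_eq_univ, contDiffWithinAt_univ] at h2
    exact h2.of_le ENat.LEInfty.out
  have hτd : DifferentiableAt ℝ τ (φ₁ (f p)) := hτ2.differentiableAt two_ne_zero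
  have hDτ : DifferentiableAt ℝ (fderiv ℝ τ) (φ₁ (f p)) :=
    (hτ2.fderiv_right (m := 1) (by norm_num)).differentiableAt one_ne_zero
  have hτc : ∀ x ∈ φ₁.source, x ∈ φ₀.source →
      fderiv ℝ τ (φ₁ x) = tangentCoordChange I (f p) x₀ x := fun x h1 h2 =>
    (hasFDerivAt_tangentCoordChange (I := I) ⟨h1, h2⟩).fderiv
  have hfc : ContinuousAt f p := by
    exact (FiberBundle.continuous_proj E (TangentSpace I : N → Type _)).continuousAt.comp
      hQ.continuousAt
  have hd := hQ.differentiableWithinAt_writtenInExtChartAt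
  rw [ModelWithCorners.range_eq_univ, differentiableWithinAt_univ] at hd
  have hy : DifferentiableAt ℝ (fun q => φ₁ (f q)) p := hd.fst
  obtain ⟨η, hηdef⟩ : ∃ η : P → E,
    η = fun q => tangentCoordChange I (f q) (f p) (f q) (V q) := ⟨_, rfl⟩
  have hη : DifferentiableAt ℝ η p := hηdef ▸ hd.snd
  have hself : η p = V p := by rw [hηdef]; exact tangentCoordChange_self hx₁
  have hev : ∀ᶠ q in 𝓝 p, f q ∈ φ₁.source ∧ f q ∈ φ₀.source :=
    (hfc.eventually (extChartAt_source_mem_nhds (f p))).and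
      (hfc.eventually ((isOpen_extChartAt_source x₀).mem_nhds hx))
  have h1 : (fun q => φ₀ (f q)) =ᶠ[𝓝 p] τ ∘ fun q => φ₁ (f q) := by
    filter_upwards [hev] with q hq
    simp only [hτ, Function.comp_apply]
    rw [φ₁.left_inv hq.1]
  have h2 : (fun q => tangentCoordChange I (f q) x₀ (f q) (V q)) =ᶠ[𝓝 p]
      fun q => fderiv ℝ τ (φ₁ (f q)) (η q) := by
    filter_upwards [hev] with q hq
    rw [hτc _ hq.1 hq.2, hηdef]
    exact (tangentCoordChange_comp (I := I) ⟨⟨mem_extChartAt_source (f q), hq.1⟩, hq.2⟩).symm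
  have h3 : fderiv ℝ (fun q => φ₀ (f q)) p u =
      fderiv ℝ τ (φ₁ (f p)) (fderiv ℝ (fun q => φ₁ (f q)) p u) := by
    rw [h1.fderiv_eq, fderiv_comp p hτd hy]
    rfl
  -- Components of vectors are not transformed by a constant map, whence the second derivative of
  -- `τ`; it equals the inhomogeneous term in the law for the Christoffel symbols.
  have h4 : fderiv ℝ (fun q => tangentCoordChange I (f q) x₀ (f q) (V q)) p u =
      fderiv ℝ τ (φ₁ (f p)) (fderiv ℝ η p u) +
      fderiv ℝ (fderiv ℝ τ) (φ₁ (f p)) (fderiv ℝ (fun q => φ₁ (f q)) p u) (η p) := by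
    have h5 : HasFDerivAt (fun q => fderiv ℝ τ (φ₁ (f q))) _ p :=
      hDτ.hasFDerivAt.comp p hy.hasFDerivAt
    rw [h2.fderiv_eq, (h5.clm_apply hη.hasFDerivAt).fderiv]
    simp
  have hmem : φ₁ (f p) ∈ φ₁.target := φ₁.map_source hx₁
  have hτp : τ (φ₁ (f p)) = φ₀ (f p) := by
    simp only [hτ, Function.comp_apply]
    rw [φ₁.left_inv hx₁]
  have hmem₀ : τ (φ₁ (f p)) ∈ φ₀.target := hτp ▸ φ₀.map_source hx
  have heq : ∀ᶠ y in 𝓝 (φ₁ (f p)), pullbackMetric G φ₁.symm y =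
      restrictForm (pullbackMetric G φ₀.symm (τ y)) (fderiv ℝ τ y) := by
    have hs : ∀ᶠ y in 𝓝 (φ₁ (f p)), φ₁.symm y ∈ φ₀.source := by
      have hc : ContinuousAt φ₁.symm (φ₁ (f p)) := continuousAt_extChartAt_symm (f p)
      refine hc.eventually ((isOpen_extChartAt_source x₀).mem_nhds ?_)
      rwa [φ₁.left_inv hx₁]
    filter_upwards [hs.eventually_nhds, (hτ2.eventually (by simp))] with y hy1 hy2
    have h6 : φ₁.symm =ᶠ[𝓝 y] φ₀.symm ∘ τ := by
      filter_upwards [hy1] with z hz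
      simp only [hτ, Function.comp_apply]
      rw [φ₀.left_inv hz]
    rw [pullbackMetric_congr G h6]
    exact pullbackMetric_comp G (mdifferentiableAt_extChartAt_symm
      (φ₀.map_source hy1.self_of_nhds)) (hy2.differentiableAt two_ne_zero)
  have hsymmτ := (hτ2.isSymmSndFDerivAt (by simp)).eq
  have htr := christoffel_transform hτ2
    ((hG.contDiffAt (f p) _ hmem).differentiableAt (by simp))
    ((hG.contDiffAt x₀ _ hmem₀).differentiableAt (by simp))
    (fun v w => hG.pullbackMetric_symm _ _ _ _) heq (hG.isInvertible hmem) (hG.isInvertible hmem₀)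
    (by rw [hτc _ hx₁ hx]; exact tangentCoordChange_surjective hx)
    (η p) (fderiv ℝ (fun q => φ₁ (f q)) p u)
  -- `V p` and the covariant derivative are replaced by variables in `E`, so that rewriting is not
  -- obstructed by their dependent types.
  have key : ∀ v₀ K : E, η p = v₀ → K = fderiv ℝ η p u +
      christoffel (pullbackMetric G φ₁.symm) (φ₁ (f p)) v₀ (fderiv ℝ (fun q => φ₁ (f q)) p u) →
      tangentCoordChange I (f p) x₀ (f p) K =
        fderiv ℝ (fun q => tangentCoordChange I (f q) x₀ (f q) (V q)) p u +
        christoffel (pullbackMetric G φ₀.symm) (φ₀ (f p)) (tangentCoordChange I (f p) x₀ (f p) v₀)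
          (fderiv ℝ (fun q => φ₀ (f q)) p u) := by
    rintro _ _ rfl rfl
    rw [map_add, ← hτc _ hx₁ hx, htr, h3, h4, hτp, hsymmτ _ (η p)]
    abel
  refine key _ _ hself ?_
  rw [hηdef]
  exact covDerivAlong_eq G hQ u

end Boundaryless

/-! ### The Sasaki metric in a natural chart, and smoothness of the metric. -/

section SasakiInChart

open Filter Topology

variable {E : Type*} [NormedAddCommGroup E] [NormedSpace ℝ E]
  {H : Type*} [TopologicalSpace H] {I : ModelWithCorners ℝ E H}
  {N : Type*} [TopologicalSpace N] [ChartedSpace H N]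
  {P : Type*} [NormedAddCommGroup P] [NormedSpace ℝ P]

theorem mem_extChartAt_tangent_target [IsManifold I 1 N] {Q₀ : TangentBundle I N} {p : E × E} :
    p ∈ (extChartAt I.tangent Q₀).target ↔ p.1 ∈ (extChartAt I Q₀.proj).target := by
  erw [FiberBundle.extChartAt_target (IB := I) (F := E) (E := (TangentSpace I : N → Type _)) Q₀]
  simp only [mem_prod, mem_inter_iff, mem_univ, and_true, and_iff_left_iff_imp]
  intro h
  have := (extChartAt I Q₀.proj).map_target h
  rwa [extChartAt_source] at this

theorem proj_mem_source [IsManifold I 1 N] {Q₀ Q : TangentBundle I N}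
    (h : Q ∈ (extChartAt I.tangent Q₀).source) : Q.proj ∈ (extChartAt I Q₀.proj).source := by
  rw [extChartAt_source] at h ⊢
  exact (TangentBundle.mem_chart_source_iff Q Q₀).1 h

theorem mdifferentiableAt_proj [IsManifold I ∞ N] (Q : TangentBundle I N) :
    MDifferentiableAt I.tangent I (Bundle.TotalSpace.proj : TangentBundle I N → N) Q :=
  (Bundle.contMDiff_proj (n := 1) (TangentSpace I : N → Type _)).mdifferentiableAt one_ne_zero

variable [I.Boundaryless] [IsManifold I ∞ N]

/-- The Sasaki metric in the natural chart of the tangent bundle. -/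
theorem pullbackMetric_sasakiMetric [FiniteDimensional ℝ E] {G : BilinField I N}
    (hG : IsSmoothMetric G) (Q₀ : TangentBundle I N) {p : E × E}
    (hp : p.1 ∈ (extChartAt I Q₀.proj).target) :
    pullbackMetric (sasakiMetric G) (extChartAt I.tangent Q₀).symm p =
      sasakiForm (pullbackMetric G (extChartAt I Q₀.proj).symm) p := by
  have hp' := mem_extChartAt_tangent_target.2 hp
  set x₀ := Q₀.proj
  set ψ := extChartAt I.tangent Q₀ with hψ
  set f : E × E → N := fun q => (ψ.symm q).proj with hf
  have hQ : MDifferentiableAt 𝓘(ℝ, E × E) I.tangent ψ.symm p :=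
    mdifferentiableAt_extChartAt_symm hp'
  have hx : f p ∈ (extChartAt I x₀).source := proj_mem_source (ψ.map_target hp')
  have hev : ∀ q ∈ ψ.target, extChartAt I x₀ (f q) = q.1 ∧
      tangentCoordChange I (f q) x₀ (f q) (ψ.symm q).snd = q.2 := fun q hq => by
    have h := ψ.right_inv hq
    rw [hψ, extChartAt_tangent_apply] at h
    exact Prod.ext_iff.1 h
  have hopen : ∀ᶠ q in 𝓝 p, q ∈ ψ.target := (isOpen_extChartAt_target Q₀).mem_nhds hp'
  have h1 : (fun q => extChartAt I x₀ (f q)) =ᶠ[𝓝 p] Prod.fst :=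
    hopen.mono fun q hq => (hev q hq).1
  have h2 : (fun q => tangentCoordChange I (f q) x₀ (f q) (ψ.symm q).snd) =ᶠ[𝓝 p] Prod.snd :=
    hopen.mono fun q hq => (hev q hq).2
  -- The connection map applied to the differential of `ψ.symm` is the covariant derivative of the
  -- tautological field `(ψ.symm q).snd` along `f`. In the chart at `x₀`, `f` and this field are the
  -- two coordinate projections.
  have hK : ∀ X : E × E, tangentCoordChange I (f p) x₀ (f p)
      (connectionMap G (ψ.symm p) (mfderiv 𝓘(ℝ, E × E) I.tangent ψ.symm p X)) =
      X.2 + christoffel (pullbackMetric G (extChartAt I x₀).symm) p.1 p.2 X.1 := fun X => by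
    have h := tangentCoordChange_covDerivAlong hG (f := f) (V := fun q => (ψ.symm q).snd) hQ hx X
    rw [h1.fderiv_eq, h2.fderiv_eq, (hev p hp').1, (hev p hp').2, fderiv_fst, fderiv_snd] at h
    exact h
  have hπ : ∀ X : E × E, tangentCoordChange I (f p) x₀ (f p)
      (mfderiv I.tangent I (Bundle.TotalSpace.proj : TangentBundle I N → N) (ψ.symm p)
        (mfderiv 𝓘(ℝ, E × E) I.tangent ψ.symm p X)) = X.1 := fun X => by
    have h3 : MDifferentiableAt 𝓘(ℝ, E × E) I f p :=
      (mdifferentiableAt_proj (ψ.symm p)).comp p hQ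
    have h := tangentCoordChange_mfderiv h3 hx X
    rw [h1.fderiv_eq, fderiv_fst] at h
    have h4 := mfderiv_comp p (mdifferentiableAt_proj (ψ.symm p)) hQ
    exact (congrArg (fun A : E × E →L[ℝ] E => tangentCoordChange I (f p) x₀ (f p) (A X))
      h4.symm).trans h
  refine ContinuousLinearMap.ext fun X => ContinuousLinearMap.ext fun Y => ?_
  have h5 := fun v w => pullbackMetric_extChartAt_symm_apply G hx v w
  rw [(hev p hp').1] at h5
  have h6 := h5 (mfderiv I.tangent I (Bundle.TotalSpace.proj : TangentBundle I N → N) (ψ.symm p)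
    (mfderiv 𝓘(ℝ, E × E) I.tangent ψ.symm p X))
    (mfderiv I.tangent I (Bundle.TotalSpace.proj : TangentBundle I N → N) (ψ.symm p)
    (mfderiv 𝓘(ℝ, E × E) I.tangent ψ.symm p Y))
  have h7 := h5 (connectionMap G (ψ.symm p) (mfderiv 𝓘(ℝ, E × E) I.tangent ψ.symm p X))
    (connectionMap G (ψ.symm p) (mfderiv 𝓘(ℝ, E × E) I.tangent ψ.symm p Y))
  rw [hπ, hπ] at h6
  rw [hK, hK] at h7
  exact (congrArg₂ (· + ·) h6 h7).symm

omit [I.Boundaryless] in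
theorem contMDiffAt_section_iff {f : P → N} {V : ∀ p : P, TangentSpace I (f p)} {p : P}
    {n : WithTop ℕ∞} :
    ContMDiffAt 𝓘(ℝ, P) I.tangent n (fun q => (⟨f q, V q⟩ : TangentBundle I N)) p ↔
      ContMDiffAt 𝓘(ℝ, P) I n f p ∧
        ContDiffAt ℝ n (fun q => tangentCoordChange I (f q) (f p) (f q) (V q)) p := by
  rw [← contMDiffAt_iff_contDiffAt]
  exact Bundle.contMDiffAt_totalSpace

omit [I.Boundaryless] in
theorem contDiffAt_extChartAt_comp {f : P → N} {p : P} {n : ℕ∞}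
    (hf : ContMDiffAt 𝓘(ℝ, P) I n f p) :
    ContDiffAt ℝ n (fun q => extChartAt I (f p) (f q)) p := by
  have : IsManifold I n N := .of_le (n := ∞) (by exact_mod_cast le_top)
  exact (contMDiffAt_extChartAt.comp p hf).contDiffAt

theorem eventually_tangentCoordChange_mfderiv {f : P → N} {p : P}
    (hf : ContMDiffAt 𝓘(ℝ, P) I 1 f p) :
    ∀ᶠ q in 𝓝 p, ∀ v, tangentCoordChange I (f q) (f p) (f q) (mfderiv 𝓘(ℝ, P) I f q v) =
      fderiv ℝ (fun q => extChartAt I (f p) (f q)) q v := by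
  filter_upwards [(contMDiffAt_iff_contMDiffAt_nhds (by simp)).1 hf,
    hf.continuousAt.eventually (extChartAt_source_mem_nhds (I := I) (f p))] with q hq hq' v
  exact tangentCoordChange_mfderiv (hq.mdifferentiableAt one_ne_zero) hq' v

theorem contMDiffAt_mfderiv_apply {f : P → N} {p : P} (hf : ContMDiffAt 𝓘(ℝ, P) I 2 f p) (v : P) :
    ContMDiffAt 𝓘(ℝ, P) I.tangent 1
      (fun q => (⟨f q, mfderiv 𝓘(ℝ, P) I f q v⟩ : TangentBundle I N)) p := by
  rw [contMDiffAt_section_iff]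
  refine ⟨hf.of_le one_le_two, ?_⟩
  have h := (((contDiffAt_extChartAt_comp (n := 2) hf).fderiv_right (m := 1)
    (by norm_num)).clm_apply (contDiffAt_const (c := v)))
  exact h.congr_of_eventuallyEq
    ((eventually_tangentCoordChange_mfderiv (hf.of_le one_le_two)).mono fun q hq => hq v)

/-- The metric of a smooth Riemannian manifold. -/
theorem isSmoothMetric_inner [FiniteDimensional ℝ E]
    (g : Bundle.ContMDiffRiemannianMetric I ∞ E (fun x : N => TangentSpace I x)) :
    IsSmoothMetric (I := I) (N := N) g.inner where
  symm := g.symm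
  pos := g.pos
  contDiffAt x₀ y hy := by
    have h : ∀ v w, ContDiffOn ℝ ∞
        (fun y => pullbackMetric g.inner (extChartAt I x₀).symm y v w) (extChartAt I x₀).target := by
      intro v w
      -- The coordinate field of constant components `v` is the inverse natural chart of `TN` at the
      -- points `(y, v)`, which is smooth.
      have hs : ∀ v : E, ContMDiffOn 𝓘(ℝ, E) I.tangent ∞ (fun y =>
          (⟨(extChartAt I x₀).symm y, mfderiv 𝓘(ℝ, E) I (extChartAt I x₀).symm y v⟩ :
            TangentBundle I N)) (extChartAt I x₀).target := by
        intro v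
        have h1 : ContMDiffOn 𝓘(ℝ, E) 𝓘(ℝ, E × E) ∞ (fun y => (y, v)) (extChartAt I x₀).target :=
          (contDiff_id.prodMk contDiff_const).contMDiff.contMDiffOn
        have h2 := contMDiffOn_extChartAt_symm (n := ∞) (I := I.tangent)
          (⟨x₀, 0⟩ : TangentBundle I N)
        have h3 := h2.comp h1 fun y hy => mem_extChartAt_tangent_target.2 hy
        refine h3.congr fun y hy => ?_
        set x := (extChartAt I x₀).symm y with hx
        have hxs : x ∈ (extChartAt I x₀).source := (extChartAt I x₀).map_target hy
        have h4 : (⟨x, mfderiv 𝓘(ℝ, E) I (extChartAt I x₀).symm y v⟩ : TangentBundle I N) ∈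
            (extChartAt I.tangent (⟨x₀, 0⟩ : TangentBundle I N)).source := by
          rw [extChartAt_source] at hxs ⊢
          exact (TangentBundle.mem_chart_source_iff _ _).2 hxs
        rw [← (extChartAt I.tangent (⟨x₀, 0⟩ : TangentBundle I N)).left_inv h4]
        refine congrArg _ (Prod.ext ((extChartAt I x₀).right_inv hy) ?_)
        have h5 := mfderiv_extChartAt_symm_apply hy v
        refine (congrArg (tangentCoordChange I x x₀ x) h5).trans ?_
        rw [tangentCoordChange_comp ⟨⟨hxs, mem_extChartAt_source _⟩, hxs⟩,
          tangentCoordChange_self hxs]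
      have hg : ContMDiffOn 𝓘(ℝ, E) (I.prod 𝓘(ℝ, E →L[ℝ] E →L[ℝ] ℝ)) ∞
          (fun y => Bundle.TotalSpace.mk' (E →L[ℝ] E →L[ℝ] ℝ)
            (E := fun x : N => TangentSpace I x →L[ℝ] TangentSpace I x →L[ℝ] ℝ)
            ((extChartAt I x₀).symm y) (g.inner ((extChartAt I x₀).symm y)))
          (extChartAt I x₀).target :=
        g.contMDiff.comp_contMDiffOn (contMDiffOn_extChartAt_symm x₀)
      intro y hy
      have h1 : ContMDiffWithinAt 𝓘(ℝ, E) (I.prod 𝓘(ℝ)) ∞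
          (fun y => Bundle.TotalSpace.mk' ℝ (E := Bundle.Trivial N ℝ) ((extChartAt I x₀).symm y)
            (g.inner ((extChartAt I x₀).symm y) (mfderiv 𝓘(ℝ, E) I (extChartAt I x₀).symm y v)
              (mfderiv 𝓘(ℝ, E) I (extChartAt I x₀).symm y w))) (extChartAt I x₀).target y :=
        ContMDiffWithinAt.clm_bundle_apply₂ (F₁ := E) (F₂ := E) (hg y hy) (hs v y hy) (hs w y hy)
      exact (Bundle.contMDiffWithinAt_totalSpace.1 h1).2.contDiffWithinAt
    have h1 : ContDiffOn ℝ ∞ (pullbackMetric g.inner (extChartAt I x₀).symm)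
        (extChartAt I x₀).target :=
      contDiffOn_clm_apply.2 fun v => contDiffOn_clm_apply.2 fun w => h v w
    exact h1.contDiffAt ((isOpen_extChartAt_target x₀).mem_nhds hy)

end SasakiInChart

/-! ### First-order geometry of the cylinder: differential, induced metric, regularity. -/

section Cylinder

open Filter Topology

variable {E : Type*} [NormedAddCommGroup E] [NormedSpace ℝ E]
  {H : Type*} [TopologicalSpace H] {I : ModelWithCorners ℝ E H}
  {N : Type*} [TopologicalSpace N] [ChartedSpace H N]

variable [IsManifold I ∞ N] {G : BilinField I N} {J : Set ℝ} {γ : ℝ → N}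
  {e : ∀ s : ℝ, TangentSpace I (γ s)} {ρ : ℝ → ℝ} {s : ℝ}

/-- The components of a vector field along a curve in the preferred chart at `x₀`. -/
def coordAlong (x₀ : N) (V : ∀ s : ℝ, TangentSpace I (γ s)) (s : ℝ) : E :=
  tangentCoordChange I (γ s) x₀ (γ s) (V s)

theorem coordAlong_self (V : ∀ s : ℝ, TangentSpace I (γ s)) (s : ℝ) :
    coordAlong (γ s) V s = V s :=
  tangentCoordChange_self (mem_extChartAt_source _)

/-- Coordinate changes are linear on the fibres, so the cylinder keeps its form in a natural chart
and the coordinate results apply. -/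
theorem extChartAt_cylinder (γ : ℝ → N) (e : ∀ s : ℝ, TangentSpace I (γ s)) (ρ : ℝ → ℝ)
    (p q : ℝ × ℝ) :
    extChartAt I.tangent (cylinder I γ e ρ p) (cylinder I γ e ρ q) =
      coordCylinder (fun s => extChartAt I (γ p.1) (γ s)) (coordAlong (γ p.1) e) ρ q := by
  rw [extChartAt_tangent_apply]
  exact Prod.ext rfl ((tangentCoordChange I (γ q.1) (γ p.1) (γ q.1)).map_smul _ (e q.1))

theorem contDiffAt_coordAlong {V : ∀ s : ℝ, TangentSpace I (γ s)} {n : WithTop ℕ∞}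
    (hV : ContMDiffAt 𝓘(ℝ, ℝ) I.tangent n (fun s => (⟨γ s, V s⟩ : TangentBundle I N)) s) :
    ContDiffAt ℝ n (coordAlong (γ s) V) s :=
  (contMDiffAt_section_iff.1 hV).2

theorem contMDiffAt_cylinder {n : WithTop ℕ∞} {p : ℝ × ℝ}
    (he : ContMDiffAt 𝓘(ℝ, ℝ) I.tangent n (fun s => (⟨γ s, e s⟩ : TangentBundle I N)) p.1)
    (hρ : ContDiffAt ℝ n ρ p.1) :
    ContMDiffAt 𝓘(ℝ, ℝ × ℝ) I.tangent n (cylinder I γ e ρ) p := by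
  have hfst : ContMDiffAt 𝓘(ℝ, ℝ × ℝ) 𝓘(ℝ, ℝ) n Prod.fst p := contDiffAt_fst.contMDiffAt
  refine (contMDiffAt_section_iff (f := fun p : ℝ × ℝ => γ p.1)
    (V := fun p => (p.2 * ρ p.1) • e p.1)).2
    ⟨(contMDiffAt_section_iff.1 he).1.comp p hfst, ?_⟩
  have h : ContDiffAt ℝ n (fun q : ℝ × ℝ => (q.2 * ρ q.1) • coordAlong (γ p.1) e q.1) p :=
    (contDiffAt_snd.mul (hρ.comp p contDiffAt_fst)).smul
      ((contDiffAt_coordAlong he).comp p contDiffAt_fst)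
  exact h.congr_of_eventuallyEq (Filter.Eventually.of_forall fun q =>
    (tangentCoordChange I (γ q.1) (γ p.1) (γ q.1)).map_smul _ (e q.1))

theorem mfderiv_proj_mfderiv_cylinder {p : ℝ × ℝ}
    (he : ContMDiffAt 𝓘(ℝ, ℝ) I.tangent 1 (fun s => (⟨γ s, e s⟩ : TangentBundle I N)) p.1)
    (hρ : ContDiffAt ℝ 1 ρ p.1) (u : ℝ × ℝ) :
    mfderiv I.tangent I (Bundle.TotalSpace.proj : TangentBundle I N → N) (cylinder I γ e ρ p)
      (mfderiv 𝓘(ℝ, ℝ × ℝ) I.tangent (cylinder I γ e ρ) p u) = u.1 • velocity I γ p.1 := by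
  have hr := (contMDiffAt_cylinder he hρ).mdifferentiableAt one_ne_zero
  have hγ : MDifferentiableAt 𝓘(ℝ, ℝ) I γ p.1 :=
    (contMDiffAt_section_iff.1 he).1.mdifferentiableAt one_ne_zero
  have h1 := mfderiv_comp p (mdifferentiableAt_proj (cylinder I γ e ρ p)) hr
  have h2 : mfderiv 𝓘(ℝ, ℝ × ℝ) I (γ ∘ Prod.fst) p = _ :=
    mfderiv_comp p hγ (differentiableAt_fst (𝕜 := ℝ) (E := ℝ) (F := ℝ) (p := p)).mdifferentiableAt
  rw [mfderiv_eq_fderiv, fderiv_fst] at h2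
  have h3 : (mfderiv 𝓘(ℝ, ℝ × ℝ) I (γ ∘ Prod.fst) p : ℝ × ℝ →L[ℝ] E) u = u.1 • velocity I γ p.1 := by
    rw [h2]
    have h4 : ∀ L : ℝ →L[ℝ] E, L u.1 = u.1 • L 1 := fun L => by rw [← map_smul]; simp
    exact h4 _
  exact (congrArg (fun A : ℝ × ℝ →L[ℝ] E => A u) h1.symm).trans h3

/-- By the Leibniz rule only the coefficient `tρ` contributes, `e` being parallel. -/
theorem connectionMap_mfderiv_cylinder {p : ℝ × ℝ}
    (he : ContMDiffAt 𝓘(ℝ, ℝ) I.tangent 1 (fun s => (⟨γ s, e s⟩ : TangentBundle I N)) p.1)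
    (hpar : covDerivAlong G γ e p.1 1 = 0)
    (hρ : ContDiffAt ℝ 1 ρ p.1) (u : ℝ × ℝ) :
    connectionMap G (cylinder I γ e ρ p)
      (mfderiv 𝓘(ℝ, ℝ × ℝ) I.tangent (cylinder I γ e ρ) p u) =
      mulFstDeriv ρ p u • e p.1 := by
  have hr := (contMDiffAt_cylinder he hρ).mdifferentiableAt one_ne_zero
  have hγ : ContMDiffAt 𝓘(ℝ, ℝ) I 1 γ p.1 := (contMDiffAt_section_iff.1 he).1
  have hy := (contDiffAt_extChartAt_comp (n := 1) hγ).differentiableAt one_ne_zero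
  have hê := (contDiffAt_coordAlong he).differentiableAt one_ne_zero
  have h1 := covDerivAlong_eq G (f := fun p : ℝ × ℝ => γ p.1)
    (V := fun p => (p.2 * ρ p.1) • e p.1) hr u
  have h2 := covDerivAlong_eq G (he.mdifferentiableAt one_ne_zero) 1
  rw [hpar] at h2
  have h3 := fderiv_coordCylinder hy hê (hρ.differentiableAt one_ne_zero) u
  have h4 : coordCylinder (fun s => extChartAt I (γ p.1) (γ s)) (coordAlong (γ p.1) e) ρ =
    fun q => (extChartAt I (γ p.1) (γ q.1), tangentCoordChange I (γ q.1) (γ p.1) (γ q.1)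
      ((q.2 * ρ q.1) • e q.1)) := funext fun q => (extChartAt_cylinder γ e ρ p q).symm
  have hd : DifferentiableAt ℝ (fun q : ℝ × ℝ => (extChartAt I (γ p.1) (γ q.1),
      tangentCoordChange I (γ q.1) (γ p.1) (γ q.1) ((q.2 * ρ q.1) • e q.1))) p :=
    h4 ▸ (contDiffAt_coordCylinder (n := 1) (contDiffAt_extChartAt_comp (n := 1) hγ)
      (contDiffAt_coordAlong he) hρ).differentiableAt one_ne_zero
  rw [h4, fderiv_fun_prodMk hd] at h3
  obtain ⟨hA, hB⟩ := Prod.ext_iff.1 h3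
  dsimp only at hA hB
  have key : ∀ e₀ K : E, coordAlong (γ p.1) e p.1 = e₀ →
      0 = deriv (coordAlong (γ p.1) e) p.1 +
        christoffel (pullbackMetric G (extChartAt I (γ p.1)).symm) (extChartAt I (γ p.1) (γ p.1))
          e₀ (deriv (fun s => extChartAt I (γ p.1) (γ s)) p.1) →
      K = fderiv ℝ (fun q : ℝ × ℝ => tangentCoordChange I (γ q.1) (γ p.1) (γ q.1)
          ((q.2 * ρ q.1) • e q.1)) p u +
        christoffel (pullbackMetric G (extChartAt I (γ p.1)).symm) (extChartAt I (γ p.1) (γ p.1))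
          ((p.2 * ρ p.1) • e₀) (fderiv ℝ (fun q : ℝ × ℝ => extChartAt I (γ p.1) (γ q.1)) p u) →
      K = mulFstDeriv ρ p u • e₀ := by
    rintro _ _ rfl h5 rfl
    rw [hA, hB, christoffel_smul_smul, mulFstDeriv_apply, add_assoc, ← smul_add, ← h5, smul_zero,
      add_zero]
  exact key _ _ (coordAlong_self e p.1) h2 h1

theorem pullbackMetric_cylinder {p : ℝ × ℝ}
    (he : ContMDiffAt 𝓘(ℝ, ℝ) I.tangent 1 (fun s => (⟨γ s, e s⟩ : TangentBundle I N)) p.1)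
    (hpar : covDerivAlong G γ e p.1 1 = 0) (hunit : G (γ p.1) (e p.1) (e p.1) = 1)
    (hρ : ContDiffAt ℝ 1 ρ p.1) :
    pullbackMetric (sasakiMetric G) (cylinder I γ e ρ) p =
      cylinderForm (G (γ p.1) (velocity I γ p.1) (velocity I γ p.1)) ρ p := by
  have key : ∀ (B : E →L[ℝ] E →L[ℝ] ℝ) (a b : E) (c₁ c₂ c₃ c₄ : ℝ), B b b = 1 →
      B (c₁ • a) (c₂ • a) + B (c₃ • b) (c₄ • b) = B a a * (c₁ * c₂) + c₃ * c₄ := by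
    intro B a b c₁ c₂ c₃ c₄ h
    simp [h]
    ring
  have hsas : ∀ X Y : E × E, ∀ x₁ x₂ y₁ y₂ : E,
      mfderiv I.tangent I (Bundle.TotalSpace.proj : TangentBundle I N → N)
        (cylinder I γ e ρ p) X = x₁ → connectionMap G (cylinder I γ e ρ p) X = x₂ →
      mfderiv I.tangent I (Bundle.TotalSpace.proj : TangentBundle I N → N)
        (cylinder I γ e ρ p) Y = y₁ → connectionMap G (cylinder I γ e ρ p) Y = y₂ →
      (sasakiMetric G (cylinder I γ e ρ p) : E × E →L[ℝ] E × E →L[ℝ] ℝ) X Y =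
        (G (γ p.1) : E →L[ℝ] E →L[ℝ] ℝ) x₁ y₁ + (G (γ p.1) : E →L[ℝ] E →L[ℝ] ℝ) x₂ y₂ := by
    rintro X Y _ _ _ _ rfl rfl rfl rfl
    rfl
  refine ContinuousLinearMap.ext fun u => ContinuousLinearMap.ext fun v => ?_
  refine (hsas _ _ _ _ _ _ (mfderiv_proj_mfderiv_cylinder he hρ u)
    (connectionMap_mfderiv_cylinder he hpar hρ u) (mfderiv_proj_mfderiv_cylinder he hρ v)
    (connectionMap_mfderiv_cylinder he hpar hρ v)).trans ?_
  exact key _ _ _ _ _ _ _ hunit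

theorem mfderiv_proj_apply [I.Boundaryless] (Q : TangentBundle I N) (X : E × E) :
    mfderiv I.tangent I (Bundle.TotalSpace.proj : TangentBundle I N → N) Q X = X.1 := by
  have hw : writtenInExtChartAt I.tangent I Q
      (Bundle.TotalSpace.proj : TangentBundle I N → N) =ᶠ[𝓝 (extChartAt I.tangent Q Q)]
      Prod.fst := by
    filter_upwards [extChartAt_target_mem_nhds (I := I.tangent) Q] with q hq
    have h := (extChartAt I.tangent Q).right_inv hq
    rw [extChartAt_tangent_apply] at h
    exact congrArg Prod.fst h
  rw [(mdifferentiableAt_proj Q).mfderiv, ModelWithCorners.range_eq_univ, fderivWithin_univ,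
    hw.fderiv_eq]
  exact congrArg (fun A : E × E →L[ℝ] E => A X) fderiv_fst

/-- The projection and the connection map are jointly injective, so the kernel of the differential
is given by `u₁γ' = 0` and `d(tρ)(u) = 0`. -/
theorem isRegularAt_cylinder_iff [I.Boundaryless] {p : ℝ × ℝ}
    (he : ContMDiffAt 𝓘(ℝ, ℝ) I.tangent 1 (fun s => (⟨γ s, e s⟩ : TangentBundle I N)) p.1)
    (hpar : covDerivAlong G γ e p.1 1 = 0) (he0 : e p.1 ≠ 0) (hρ : ContDiffAt ℝ 1 ρ p.1) :
    IsRegularAt I.tangent (cylinder I γ e ρ) p ↔ velocity I γ p.1 ≠ 0 ∧ ρ p.1 ≠ 0 := by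
  have hzero : ∀ X : E × E, mfderiv I.tangent I (Bundle.TotalSpace.proj : TangentBundle I N → N)
      (cylinder I γ e ρ p) X = 0 → connectionMap G (cylinder I γ e ρ p) X = 0 → X = 0 := by
    intro X h1 h2
    rw [mfderiv_proj_apply] at h1
    have h3 : X.2 + christoffelAt G (γ p.1) ((p.2 * ρ p.1) • e p.1) X.1 = 0 := h2
    have h4 : X.1 = 0 := h1
    rw [h4, map_zero, add_zero] at h3
    exact Prod.ext h4 h3
  have hiff : ∀ u : ℝ × ℝ, mfderiv 𝓘(ℝ, ℝ × ℝ) I.tangent (cylinder I γ e ρ) p u = 0 ↔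
      u.1 • velocity I γ p.1 = 0 ∧ mulFstDeriv ρ p u • e p.1 = 0 := by
    intro u
    rw [← mfderiv_proj_mfderiv_cylinder he hρ, ← connectionMap_mfderiv_cylinder he hpar hρ]
    exact ⟨fun h => by rw [h, map_zero, map_zero]; exact ⟨rfl, rfl⟩, fun h => hzero _ h.1 h.2⟩
  have hinj : IsRegularAt I.tangent (cylinder I γ e ρ) p ↔
      ∀ u : ℝ × ℝ, mfderiv 𝓘(ℝ, ℝ × ℝ) I.tangent (cylinder I γ e ρ) p u = 0 → u = 0 :=
    injective_iff_map_eq_zero _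
  rw [hinj]
  simp_rw [hiff, smul_eq_zero, he0, or_false, mulFstDeriv_apply]
  constructor
  · intro h
    constructor
    · intro hv
      -- This vector annihilates `d(tρ)`. When `γ' = 0` it lies in the kernel, forcing `ρ = 0`; then
      -- `(0, 1)` lies in the kernel as well.
      have h1 := h (ρ p.1, -(p.2 * deriv ρ p.1)) ⟨Or.inr hv, by ring⟩
      have h2 := congrArg Prod.fst h1
      have h3 := h (0, 1) ⟨Or.inl rfl, by simpa using h2⟩
      simpa using congrArg Prod.snd h3
    · intro hρ0
      simpa using congrArg Prod.snd (h (0, 1) ⟨Or.inl rfl, by simp [hρ0]⟩)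
  · rintro ⟨hv, hρ0⟩ u ⟨h1, h2⟩
    have h3 : u.1 = 0 := h1.resolve_right hv
    rw [h3, mul_zero, add_zero] at h2
    exact Prod.ext h3 ((mul_eq_zero.1 h2).resolve_right hρ0)

variable [I.Boundaryless] [FiniteDimensional ℝ E]

/-- Each covariant derivative is defined in the chart of its own base point; here all of them near
`s` are written in the single chart at `γ s`, giving an equation that holds on a neighbourhood. -/
theorem eventually_deriv_coordAlong_add_christoffel (hG : IsSmoothMetric G) (hJ : IsOpen J)
    (hs : s ∈ J) {V : ∀ s : ℝ, TangentSpace I (γ s)}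
    (hV : ∀ s ∈ J, MDifferentiableAt 𝓘(ℝ, ℝ) I.tangent
      (fun s => (⟨γ s, V s⟩ : TangentBundle I N)) s)
    (hpar : ∀ s ∈ J, covDerivAlong G γ V s 1 = 0) :
    ∀ᶠ s' in 𝓝 s, deriv (coordAlong (γ s) V) s' +
      christoffel (pullbackMetric G (extChartAt I (γ s)).symm) (extChartAt I (γ s) (γ s'))
        (coordAlong (γ s) V s') (deriv (fun s' => extChartAt I (γ s) (γ s')) s') = 0 := by
  have hγ : ContinuousAt γ s :=
    (FiberBundle.continuous_proj E (TangentSpace I : N → Type _)).continuousAt.comp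
      (hV s hs).continuousAt
  filter_upwards [hJ.mem_nhds hs, hγ.eventually (extChartAt_source_mem_nhds (I := I) (γ s))]
    with s' hs' hx
  have h := tangentCoordChange_covDerivAlong hG (hV s' hs') hx 1
  rw [hpar s' hs'] at h
  exact h.symm.trans (map_zero (tangentCoordChange I (γ s') (γ s) (γ s')))

omit [FiniteDimensional ℝ E] in
theorem eventually_coordAlong_velocity (hγ : ContMDiffAt 𝓘(ℝ, ℝ) I 1 γ s) :
    ∀ᶠ s' in 𝓝 s, coordAlong (γ s) (velocity I γ) s' =
      deriv (fun s' => extChartAt I (γ s) (γ s')) s' :=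
  (eventually_tangentCoordChange_mfderiv hγ).mono fun _ h => h 1

end Cylinder

/-! ### Constant speed, flatness and total geodesy on the manifold. -/

section TotallyGeodesicFlat

open Filter Topology

/-- The derivative of `g` along `y'` at `(y', y')` equals `2 g(Γ(y', y'), y')`, which the geodesic
equation cancels. -/
theorem deriv_energy_eq_zero {P : Type*} [NormedAddCommGroup P] [NormedSpace ℝ P]
    {g : P → P →L[ℝ] P →L[ℝ] ℝ} {y : ℝ → P} {s : ℝ} (hg : DifferentiableAt ℝ g (y s))
    (hs : ∀ v w, g (y s) v w = g (y s) w v) (hinv : (g (y s)).IsInvertible)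
    (hy : DifferentiableAt ℝ y s) (hy' : DifferentiableAt ℝ (deriv y) s)
    (hgeo : deriv (deriv y) s + christoffel g (y s) (deriv y s) (deriv y s) = 0) :
    HasDerivAt (fun s => g (y s) (deriv y s) (deriv y s)) 0 s := by
  have hgy : DifferentiableAt ℝ (fun s => g (y s)) s := hg.comp s hy
  have hgyD : deriv (fun s => g (y s)) s = fderiv ℝ g (y s) (deriv y s) :=
    fderiv_comp_deriv s hg hy
  have h := ((hgy.clm_apply hy').clm_apply hy').hasDerivAt
  have hneg : ∀ (B : P →L[ℝ] P →L[ℝ] ℝ) (v w : P), B (-v) w = -B v w := by simp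
  rwa [deriv_bilin_apply hgy hy' hy', hgyD, hs (deriv y s), eq_neg_of_add_eq_zero_left hgeo, hneg,
    apply_christoffel _ _ hinv, koszulForm_apply,
    show ∀ x : ℝ, x + -(2⁻¹ * (x + x - x)) + -(2⁻¹ * (x + x - x)) = 0 from fun x => by ring] at h

variable {E : Type*} [NormedAddCommGroup E] [NormedSpace ℝ E] [FiniteDimensional ℝ E]
  {H : Type*} [TopologicalSpace H] {I : ModelWithCorners ℝ E H} [I.Boundaryless]
  {N : Type*} [TopologicalSpace N] [ChartedSpace H N] [IsManifold I ∞ N]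
  {G : BilinField I N} {J : Set ℝ} {γ : ℝ → N}
  {e : ∀ s : ℝ, TangentSpace I (γ s)} {ρ : ℝ → ℝ} {s : ℝ}

theorem eventually_geodesic_equation (hG : IsSmoothMetric G) (hJ : IsOpen J)
    (hγ : IsGeodesicOn G γ J) (hs : s ∈ J) :
    ∀ᶠ s' in 𝓝 s, deriv (deriv fun s' => extChartAt I (γ s) (γ s')) s' +
      christoffel (pullbackMetric G (extChartAt I (γ s)).symm) (extChartAt I (γ s) (γ s'))
        (deriv (fun s' => extChartAt I (γ s) (γ s')) s')
        (deriv (fun s' => extChartAt I (γ s) (γ s')) s') = 0 := by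
  have hγc : ∀ s ∈ J, ContMDiffAt 𝓘(ℝ, ℝ) I 2 γ s := fun s hs =>
    (hγ.1.contMDiffAt (hJ.mem_nhds hs)).of_le ENat.LEInfty.out
  filter_upwards [eventually_deriv_coordAlong_add_christoffel hG hJ hs (V := velocity I γ)
    (fun s hs => (contMDiffAt_mfderiv_apply (hγc s hs) (1 : ℝ)).mdifferentiableAt one_ne_zero) hγ.2,
    (eventually_coordAlong_velocity ((hγc s hs).of_le one_le_two)).eventually_nhds] with s' h1 h2
  have h3 : coordAlong (γ s) (velocity I γ) =ᶠ[𝓝 s'] deriv fun s' => extChartAt I (γ s) (γ s') := h2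
  rwa [h3.deriv_eq, h3.self_of_nhds] at h1

/-- Constancy near `s` suffices, and is all that can hold on a disconnected `J`: the curvature at a
point depends only on the germ of the metric. -/
theorem eventually_energy_eq (hG : IsSmoothMetric G) (hJ : IsOpen J)
    (hγ : IsGeodesicOn G γ J) (hs : s ∈ J) :
    ∀ᶠ s' in 𝓝 s, G (γ s') (velocity I γ s') (velocity I γ s') =
      G (γ s) (velocity I γ s) (velocity I γ s) := by
  have hγc : ContMDiffAt 𝓘(ℝ, ℝ) I 2 γ s :=
    (hγ.1.contMDiffAt (hJ.mem_nhds hs)).of_le ENat.LEInfty.out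
  have hy := contDiffAt_extChartAt_comp (n := 2) hγc
  set y : ℝ → E := fun s' => extChartAt I (γ s) (γ s') with hydef
  set g := pullbackMetric G (extChartAt I (γ s)).symm with hgdef
  have hsource := hγc.continuousAt.eventually (extChartAt_source_mem_nhds (I := I) (γ s))
  have hen : ∀ᶠ s' in 𝓝 s, G (γ s') (velocity I γ s') (velocity I γ s') =
      g (y s') (deriv y s') (deriv y s') := by
    filter_upwards [hsource, eventually_coordAlong_velocity (hγc.of_le one_le_two)] with s' h1 h2
    rw [← h2]
    exact (pullbackMetric_extChartAt_symm_apply G h1 _ _).symm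
  have hder : ∀ᶠ s' in 𝓝 s, HasDerivAt (fun s => g (y s) (deriv y s) (deriv y s)) 0 s' := by
    filter_upwards [hsource, eventually_geodesic_equation hG hJ hγ hs,
      hy.eventually (by simp)] with s' h1 h2 h3
    have hmem := (extChartAt I (γ s)).map_source h1
    exact deriv_energy_eq_zero ((hG.contDiffAt (γ s) _ hmem).differentiableAt (by simp))
      (hG.pullbackMetric_symm _ _) (hG.isInvertible hmem) (h3.differentiableAt two_ne_zero)
      (((h3.fderiv_right (m := 1) (by norm_num)).clm_apply contDiffAt_const).differentiableAt
        one_ne_zero) h2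
  obtain ⟨ε, hε, hball⟩ := Metric.eventually_nhds_iff_ball.1 hder
  have hsε := Metric.mem_ball_self (x := s) hε
  filter_upwards [hen, Metric.ball_mem_nhds s hε] with s' h1 h2
  rw [h1, hen.self_of_nhds]
  exact Metric.isOpen_ball.is_const_of_deriv_eq_zero (convex_ball s ε).isPreconnected
    (fun x hx => (hball x hx).differentiableAt.differentiableWithinAt)
    (fun x hx => (hball x hx).deriv) h2 hsε

theorem isIntrinsicallyFlatAt_cylinder (hG : IsSmoothMetric G) (hJ : IsOpen J)
    (hγ : IsGeodesicOn G γ J) (he : IsParallelAlongOn G γ e J)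
    (hunit : ∀ s ∈ J, G (γ s) (e s) (e s) = 1) (hρ : ContDiffOn ℝ ∞ ρ J) (hs : s ∈ J)
    (hv : velocity I γ s ≠ 0) (hρ0 : ρ s ≠ 0) (t : ℝ) :
    IsIntrinsicallyFlatAt (sasakiMetric G) (cylinder I γ e ρ) (s, t) := by
  refine fun u v w => curvature_eq_zero_of_eventuallyEq_cylinderForm (hG.pos _ _ hv)
    ((hρ.contDiffAt (hJ.mem_nhds hs)).of_le ENat.LEInfty.out) hρ0 ?_ u v w
  have hfst : ContinuousAt (Prod.fst : ℝ × ℝ → ℝ) (s, t) := continuousAt_fst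
  filter_upwards [hfst.eventually ((eventually_energy_eq hG hJ hγ hs).and (hJ.mem_nhds hs))]
    with q hq
  -- The constant `a` is exchanged for the squared speed at `q`, as `pullbackMetric_cylinder`
  -- produces it.
  rw [← hq.1]
  exact pullbackMetric_cylinder ((he.1.contMDiffAt (hJ.mem_nhds hq.2)).of_le ENat.LEInfty.out)
    (he.2 _ hq.2) (hunit _ hq.2) ((hρ.contDiffAt (hJ.mem_nhds hq.2)).of_le ENat.LEInfty.out)

theorem isTotallyGeodesicAt_cylinder (hG : IsSmoothMetric G) (hJ : IsOpen J)
    (hγ : IsGeodesicOn G γ J) (he : IsParallelAlongOn G γ e J) (hρ : ContDiffOn ℝ ∞ ρ J)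
    (hs : s ∈ J) (hρ0 : ρ s ≠ 0) (t : ℝ) :
    IsTotallyGeodesicAt (sasakiMetric G) (cylinder I γ e ρ) (s, t) := by
  intro u v
  set p : ℝ × ℝ := (s, t) with hp
  have hγc : ContMDiffAt 𝓘(ℝ, ℝ) I 2 γ s :=
    (hγ.1.contMDiffAt (hJ.mem_nhds hs)).of_le ENat.LEInfty.out
  have hec : ∀ s ∈ J, ContMDiffAt 𝓘(ℝ, ℝ) I.tangent 2
      (fun s => (⟨γ s, e s⟩ : TangentBundle I N)) s := fun s hs =>
    (he.1.contMDiffAt (hJ.mem_nhds hs)).of_le ENat.LEInfty.out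
  have hρc : ContDiffAt ℝ 2 ρ s := (hρ.contDiffAt (hJ.mem_nhds hs)).of_le ENat.LEInfty.out
  have hr : ContMDiffAt 𝓘(ℝ, ℝ × ℝ) I.tangent 2 (cylinder I γ e ρ) p :=
    contMDiffAt_cylinder (hec s hs) hρc
  set r := cylinder I γ e ρ with hrdef
  set g := pullbackMetric G (extChartAt I (γ s)).symm with hg
  set f := coordCylinder (fun s' => extChartAt I (γ s) (γ s')) (coordAlong (γ s) e) ρ with hf
  have hrf : (fun q => extChartAt I.tangent (r p) (r q)) = f :=
    funext fun q => extChartAt_cylinder γ e ρ p q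
  have hmem : f p ∈ (extChartAt I.tangent (r p)).target := by
    rw [← hrf]
    exact mem_extChartAt_target (r p)
  -- Equality on a neighbourhood is essential, since Christoffel symbols involve derivatives of the
  -- metric.
  have hsas : pullbackMetric (sasakiMetric G) (extChartAt I.tangent (r p)).symm =ᶠ[𝓝 (f p)]
      sasakiForm g := by
    filter_upwards [(isOpen_extChartAt_target (r p)).mem_nhds hmem] with q hq
    exact pullbackMetric_sasakiMetric hG (r p) (mem_extChartAt_tangent_target.1 hq)
  have hy : extChartAt I (γ s) (γ s) ∈ (extChartAt I (γ s)).target := mem_extChartAt_target (γ s)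
  have htarget := extChartAt_target_mem_nhds (I := I) (γ s)
  obtain ⟨w, hw⟩ := exists_covDeriv_coordCylinder_eq (g := g) (p := p)
    (y := fun s' => extChartAt I (γ s) (γ s')) (e := coordAlong (γ s) e) (ρ := ρ)
    ((hG.contDiffAt (γ s) _ hy).of_le ENat.LEInfty.out)
    (Filter.Eventually.of_forall fun x => hG.pullbackMetric_symm _ _)
    (Filter.mem_of_superset htarget fun x hx => hG.isInvertible hx)
    (contDiffAt_extChartAt_comp (n := 2) hγc) (contDiffAt_coordAlong (hec s hs)) hρc
    (eventually_geodesic_equation hG hJ hγ hs).self_of_nhds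
    (eventually_deriv_coordAlong_add_christoffel hG hJ hs
      (fun s hs => (hec s hs).mdifferentiableAt two_ne_zero) he.2)
    (isInvertible_of_posDef fun X hX => sasakiForm_pos (hG.pullbackMetric_pos hy) hX) hρ0 u v
  have hdr : ∀ v, (mfderiv 𝓘(ℝ, ℝ × ℝ) I.tangent r p v : E × E) = fderiv ℝ f p v := fun v => by
    rw [← hrf]
    exact mfderiv_apply_eq_fderiv (hr.mdifferentiableAt two_ne_zero) v
  refine ⟨w, Eq.trans ?_ (hw.trans (hdr w).symm)⟩
  have h1 := covDerivAlong_eq (sasakiMetric G)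
    ((contMDiffAt_mfderiv_apply hr v).mdifferentiableAt one_ne_zero) u
  have h2 := (eventually_tangentCoordChange_mfderiv (hr.of_le one_le_two)).mono fun q h => h v
  have key : ∀ a : E × E, a = fderiv ℝ f p v →
      fderiv ℝ (fun q => tangentCoordChange I.tangent (r q) (r p) (r q)
        (mfderiv 𝓘(ℝ, ℝ × ℝ) I.tangent r q v)) p u +
      christoffel (pullbackMetric (sasakiMetric G) (extChartAt I.tangent (r p)).symm)
        (extChartAt I.tangent (r p) (r p)) a
        (fderiv ℝ (fun q => extChartAt I.tangent (r p) (r q)) p u) =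
      fderiv ℝ (fun q => fderiv ℝ f q v) p u +
      christoffel (sasakiForm g) (f p) (fderiv ℝ f p v) (fderiv ℝ f p u) := by
    rintro _ rfl
    rw [Filter.EventuallyEq.fderiv_eq h2, hrf, congrFun hrf p, christoffel_congr hsas]
  exact h1.trans (key _ (hdr v))

end TotallyGeodesicFlat

end SasakiCylinder

end

/-! ### The theorem for a smooth Riemannian manifold. -/

theorem mainTheorem5 (n : ℕ) {M : Type*} [TopologicalSpace M]
    [ChartedSpace (EuclideanSpace ℝ (Fin n)) M] [IsManifold (𝓡 n) ∞ M]
    (g : Bundle.ContMDiffRiemannianMetric (𝓡 n) ∞ (EuclideanSpace ℝ (Fin n))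
      (fun x : M => TangentSpace (𝓡 n) x))
    (J : Set ℝ) (hJ : IsOpen J)
    (γ : ℝ → M) (hγ : SasakiCylinder.IsGeodesicOn g.inner γ J)
    (e : ∀ s : ℝ, TangentSpace (𝓡 n) (γ s))
    (he : SasakiCylinder.IsParallelAlongOn g.inner γ e J)
    (he_unit : ∀ s ∈ J, g.inner (γ s) (e s) (e s) = 1)
    (ρ : ℝ → ℝ) (hρ : ContDiffOn ℝ ∞ ρ J) :
    ContMDiffOn 𝓘(ℝ, ℝ × ℝ) (𝓡 n).tangent ∞ (SasakiCylinder.cylinder (𝓡 n) γ e ρ)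
        (J ×ˢ (Set.univ : Set ℝ)) ∧
      ∀ s ∈ J, ∀ t : ℝ,
        (SasakiCylinder.IsRegularAt (𝓡 n).tangent (SasakiCylinder.cylinder (𝓡 n) γ e ρ) (s, t) ↔
          SasakiCylinder.velocity (𝓡 n) γ s ≠ 0 ∧ ρ s ≠ 0) ∧
        (SasakiCylinder.IsRegularAt (𝓡 n).tangent (SasakiCylinder.cylinder (𝓡 n) γ e ρ) (s, t) →
          SasakiCylinder.IsTotallyGeodesicAt (SasakiCylinder.sasakiMetric g.inner)
              (SasakiCylinder.cylinder (𝓡 n) γ e ρ) (s, t) ∧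
            SasakiCylinder.IsIntrinsicallyFlatAt (SasakiCylinder.sasakiMetric g.inner)
              (SasakiCylinder.cylinder (𝓡 n) γ e ρ) (s, t)) := by
  have hG := SasakiCylinder.isSmoothMetric_inner g
  have hec : ∀ s ∈ J, ContMDiffAt 𝓘(ℝ, ℝ) (𝓡 n).tangent ∞
      (fun s => (⟨γ s, e s⟩ : TangentBundle (𝓡 n) M)) s :=
    fun s hs => he.1.contMDiffAt (hJ.mem_nhds hs)
  have hρc : ∀ s ∈ J, ContDiffAt ℝ ∞ ρ s := fun s hs => hρ.contDiffAt (hJ.mem_nhds hs)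
  refine ⟨fun p hp => (SasakiCylinder.contMDiffAt_cylinder (hec p.1 hp.1)
    (hρc p.1 hp.1)).contMDiffWithinAt, fun s hs t => ?_⟩
  have he0 : e s ≠ 0 := fun h => by
    have h1 := he_unit s hs
    rw [h, map_zero] at h1
    exact zero_ne_one h1
  have hiff := SasakiCylinder.isRegularAt_cylinder_iff (p := (s, t))
    ((hec s hs).of_le ENat.LEInfty.out) (he.2 s hs) he0 ((hρc s hs).of_le ENat.LEInfty.out)
  refine ⟨hiff, fun hreg => ?_⟩
  obtain ⟨hv, hρ0⟩ := hiff.1 hreg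
  exact ⟨SasakiCylinder.isTotallyGeodesicAt_cylinder hG hJ hγ he hρ hs hρ0 t,
    SasakiCylinder.isIntrinsicallyFlatAt_cylinder hG hJ hγ he he_unit hρ hs hv hρ0 t⟩
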